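/- Let $1<p<N$ and $p^*=\frac{Np}{N-p}$. Let $A:\mathbb R^N\to\mathbb R$ be measurable with $A>0$ a.e., $A\in L^\infty(\mathbb R^N)$ and $A^{-1/(p-1)}\in L^1_{\mathrm{loc}}(\mathbb R^N)$. Let $W_A(\mathbb R^N)$ be the completion of $C_0^\infty(\mathbb R^N)$ for the norm $\big(\int_{\mathbb R^N}|\nabla u|^p+A(x)|u|^p\,dx\big)^{1/p}$, realized as a space of weakly differentiable functions. For an open set $\Omega\subset\mathbb R^N$, let $$W_A(\Omega)=\{u|_\Omega : u\in W_A(\mathbb R^N)\},\qquad \|u\|_{W_A(\Omega)}=\Big(\int_\Omega|\nabla u|^p+A(x)|u|^p\,dx\Big)^{1/p}.$$ For $q\ge 1$ and $B>0$ a.e. measurable, let $L^q_B(\Omega)$ be the space of measurable $u:\Omega\to\mathbb R$ with $\|u\|_{L^q_B(\Omega)}=\big(\int_\Omega|u|^qB(x)\,dx\big)^{1/q}<\infty$. Suppose that $\Omega$ is either $\mathbb R^N$ or a bounded open set with $C^1$ boundary, let $q\in(p,p^*)$, and let $B\in L^{\frac{p^*}{p^*-q}}(\mathbb R^N)\cap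 L^\infty(\mathbb R^N)$ with $B>0$ a.e. Then $W_A(\Omega)\subset L^q_B(\Omega)$, and there is a constant $C>0$ such that $$\|u\|_{L^q_B(\Omega)}\le C\,\|u\|_{W_A(\Omega)}\qquad\text{for all } u\in W_A(\Omega).$$ Furthermore, this embedding is compact: every sequence that is bounded in $W_A(\Omega)$ has a subsequence that converges in $L^q_B(\Omega)$. -/

import Mathlib

open MeasureTheory Filter Topology
open scoped ENNReal ContDiff

namespace WeightedSobolev

/-- The critical Sobolev exponent `p* = N p / (N - p)`. -/
noncomputable def pStar (N : ℕ) (p : ℝ) : ℝ := N * p / (N - p)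

/-- `φ ∈ C₀^∞(Ω)`: smooth, with compact support contained in `Ω`. -/
def IsTest {N : ℕ} (Ω : Set (EuclideanSpace ℝ (Fin N)))
    (φ : EuclideanSpace ℝ (Fin N) → ℝ) : Prop :=
  ContDiff ℝ ∞ φ ∧ HasCompactSupport φ ∧ tsupport φ ⊆ Ω

/-- `v` is the weak (distributional) gradient of `u` on the open set `Ω`:
both are in `L¹_loc(Ω)` and `∫_Ω u ∇φ = - ∫_Ω φ v` for all `φ ∈ C₀^∞(Ω)`. -/
def HasWeakGradient {N : ℕ} (Ω : Set (EuclideanSpace ℝ (Fin N)))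
    (u : EuclideanSpace ℝ (Fin N) → ℝ)
    (v : EuclideanSpace ℝ (Fin N) → EuclideanSpace ℝ (Fin N)) : Prop :=
  LocallyIntegrableOn u Ω ∧ LocallyIntegrableOn v Ω ∧
    ∀ φ : EuclideanSpace ℝ (Fin N) → ℝ, IsTest Ω φ →
      ∫ x in Ω, u x • gradient φ x = - ∫ x in Ω, φ x • v x

/-- Weak gradients are unique up to null sets. -/
theorem HasWeakGradient.ae_unique {N : ℕ} {Ω : Set (EuclideanSpace ℝ (Fin N))}
    (hΩ : IsOpen Ω) {u : EuclideanSpace ℝ (Fin N) → ℝ}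
    {v w : EuclideanSpace ℝ (Fin N) → EuclideanSpace ℝ (Fin N)}
    (hv : HasWeakGradient Ω u v) (hw : HasWeakGradient Ω u w) :
    v =ᵐ[volume.restrict Ω] w := by
  have key : ∀ᵐ x ∂(volume : Measure (EuclideanSpace ℝ (Fin N))), x ∈ Ω → v x - w x = 0 := by
    refine hΩ.ae_eq_zero_of_integral_contDiff_smul_eq_zero (hv.2.1.sub hw.2.1) ?_
    intro g hg hgc hgΩ
    have hi : ∀ z : EuclideanSpace ℝ (Fin N) → EuclideanSpace ℝ (Fin N),
        LocallyIntegrableOn z Ω → Integrable (fun x => g x • z x) := by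
      intro z hz
      have h := (hz.integrableOn_compact_subset hgΩ hgc).continuousOn_smul
        hg.continuous.continuousOn hgc
      refine (integrableOn_iff_integrable_of_support_subset fun x hx => ?_).1 h
      by_contra hx'
      exact hx (by simp [image_eq_zero_of_notMem_tsupport hx'])
    have hr : ∀ z : EuclideanSpace ℝ (Fin N) → EuclideanSpace ℝ (Fin N),
        ∫ x in Ω, g x • z x = ∫ x, g x • z x := by
      intro z
      refine setIntegral_eq_integral_of_forall_compl_eq_zero fun x hx => ?_
      rw [image_eq_zero_of_notMem_tsupport fun h => hx (hgΩ h), zero_smul]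
    have h1 := hv.2.2 g ⟨hg, hgc, hgΩ⟩
    rw [hw.2.2 g ⟨hg, hgc, hgΩ⟩, neg_inj, hr, hr] at h1
    simp only [smul_sub]
    rw [integral_sub (hi v hv.2.1) (hi w hw.2.1), h1, sub_self]
  refine (ae_restrict_iff' hΩ.measurableSet).2 ?_
  filter_upwards [key] with x hx hxΩ
  exact sub_eq_zero.1 (hx hxΩ)

open Classical in
/-- The weak gradient of `u` on `Ω` (the zero field if there is none). -/
noncomputable def weakGradient {N : ℕ} (Ω : Set (EuclideanSpace ℝ (Fin N)))
    (u : EuclideanSpace ℝ (Fin N) → ℝ) :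
    EuclideanSpace ℝ (Fin N) → EuclideanSpace ℝ (Fin N) :=
  if h : ∃ v, HasWeakGradient Ω u v then h.choose else 0

theorem HasWeakGradient.weakGradient_ae_eq {N : ℕ} {Ω : Set (EuclideanSpace ℝ (Fin N))}
    (hΩ : IsOpen Ω) {u : EuclideanSpace ℝ (Fin N) → ℝ}
    {v : EuclideanSpace ℝ (Fin N) → EuclideanSpace ℝ (Fin N)} (hv : HasWeakGradient Ω u v) :
    weakGradient Ω u =ᵐ[volume.restrict Ω] v := by
  have h : ∃ v, HasWeakGradient Ω u v := ⟨v, hv⟩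
  rw [weakGradient, dif_pos h]
  exact h.choose_spec.ae_unique hΩ hv

/-- The quantity `(∫_Ω |v|^p + A |u|^p dx)^{1/p}`. -/
noncomputable def pairNorm {N : ℕ} (p : ℝ) (A : EuclideanSpace ℝ (Fin N) → ℝ)
    (Ω : Set (EuclideanSpace ℝ (Fin N))) (u : EuclideanSpace ℝ (Fin N) → ℝ)
    (v : EuclideanSpace ℝ (Fin N) → EuclideanSpace ℝ (Fin N)) : ℝ≥0∞ :=
  (∫⁻ x in Ω, (‖v x‖ₑ ^ p + ENNReal.ofReal (A x) * ‖u x‖ₑ ^ p)) ^ (1 / p)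

/-- `‖u‖_{W_A(Ω)} = (∫_Ω |∇u|^p + A |u|^p dx)^{1/p}`. -/
noncomputable def WNorm {N : ℕ} (p : ℝ) (A : EuclideanSpace ℝ (Fin N) → ℝ)
    (Ω : Set (EuclideanSpace ℝ (Fin N))) (u : EuclideanSpace ℝ (Fin N) → ℝ) : ℝ≥0∞ :=
  pairNorm p A Ω u (weakGradient Ω u)

/-- `u ∈ W_A(ℝ^N)`, the completion of `C₀^∞(ℝ^N)` for `‖·‖_{W_A}`, realized as a space of
functions: `u` is weakly differentiable and is the limit, for this norm, of a sequence of
test functions. -/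
def MemWFull {N : ℕ} (p : ℝ) (A : EuclideanSpace ℝ (Fin N) → ℝ)
    (u : EuclideanSpace ℝ (Fin N) → ℝ) : Prop :=
  ∃ v : EuclideanSpace ℝ (Fin N) → EuclideanSpace ℝ (Fin N),
    HasWeakGradient Set.univ u v ∧
    ∃ φ : ℕ → EuclideanSpace ℝ (Fin N) → ℝ, (∀ n, IsTest Set.univ (φ n)) ∧
      Tendsto (fun n => pairNorm p A Set.univ (u - φ n) (v - gradient (φ n))) atTop (𝓝 0)

/-- `u ∈ W_A(Ω)`: on `Ω`, `u` is (a.e. equal to) the restriction of an element of `W_A(ℝ^N)`.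
Functions on `Ω` are represented by functions on the whole space, whose values outside `Ω`
are irrelevant. -/
def MemW {N : ℕ} (p : ℝ) (A : EuclideanSpace ℝ (Fin N) → ℝ)
    (Ω : Set (EuclideanSpace ℝ (Fin N))) (u : EuclideanSpace ℝ (Fin N) → ℝ) : Prop :=
  ∃ w : EuclideanSpace ℝ (Fin N) → ℝ, MemWFull p A w ∧ u =ᵐ[volume.restrict Ω] w

/-- `‖u‖_{L^q_B(Ω)} = (∫_Ω |u|^q B dx)^{1/q}`. -/
noncomputable def LqBNorm {N : ℕ} (q : ℝ) (B : EuclideanSpace ℝ (Fin N) → ℝ)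
    (Ω : Set (EuclideanSpace ℝ (Fin N))) (u : EuclideanSpace ℝ (Fin N) → ℝ) : ℝ≥0∞ :=
  (∫⁻ x in Ω, ‖u x‖ₑ ^ q * ENNReal.ofReal (B x)) ^ (1 / q)

/-- `u ∈ L^q_B(Ω)`: `u` is measurable on `Ω` and `∫_Ω |u|^q B dx < ∞`. -/
def MemLqB {N : ℕ} (q : ℝ) (B : EuclideanSpace ℝ (Fin N) → ℝ)
    (Ω : Set (EuclideanSpace ℝ (Fin N))) (u : EuclideanSpace ℝ (Fin N) → ℝ) : Prop :=
  AEStronglyMeasurable u (volume.restrict Ω) ∧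
    ∫⁻ x in Ω, ‖u x‖ₑ ^ q * ENNReal.ofReal (B x) < (⊤ : ℝ≥0∞)

/-- `Ω` has `C¹` boundary: near each boundary point, `Ω` is the set of points lying above the
graph, in some unit direction `e`, of a `C¹` function `γ` of the coordinates orthogonal
to `e`. -/
def HasC1Boundary {N : ℕ} (Ω : Set (EuclideanSpace ℝ (Fin N))) : Prop :=
  ∀ x₀ ∈ frontier Ω, ∃ (e : EuclideanSpace ℝ (Fin N)) (γ : EuclideanSpace ℝ (Fin N) → ℝ) (r : ℝ),
    ‖e‖ = 1 ∧ ContDiff ℝ 1 γ ∧ (∀ x (t : ℝ), γ (x + t • e) = γ x) ∧ 0 < r ∧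
      Ω ∩ Metric.ball x₀ r = {x | γ x < inner ℝ e x} ∩ Metric.ball x₀ r

end WeightedSobolev

/-! The proof rests on one estimate for smooth `φ`. Suppose that `Ω` contains all segments `x + t
z`, `0 < t ≤ 1`, with `x ∈ S` and `η z ≠ 0`, for a Lipschitz probability density `η` of bounded
support. Then on `S` the function `φ` differs from its average at scale `h` by at most `C h^θ
‖∇φ‖_{L^p(Ω)}` in `L^q`, where `θ = 1 - N (1/p - 1/q)` is positive because `q < p*`
(`exists_eLpNorm_sub_scaleAverage_le`). Indeed `φ x - φ (x + h z)` is an integral of `∇φ` along a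
segment, and dilated averages map `L^p` to `L^q` at the cost of a power of the dilation. The
averages only look into a cone inside `Ω`, so no extension operator is needed: at a `C¹` boundary
point the cone points inward, and by compactness finitely many such pieces cover a bounded `Ω`.

At a fixed scale the averages of an `L¹`-bounded sequence agree on `S`, up to a factor, with
uniformly bounded, uniformly Lipschitz functions. A diagonal argument makes them converge pointwise
at all scales `1/(k+1)` at once, and the estimate above turns this into a Cauchy property in
`L^q(S)`. The `L¹` bound on bounded sets is Hölder's inequality with `A^{-1/(p-1)} ∈ L¹_loc`, and
boundedness of `B` passes from `L^q` to `L^q_B`.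

On the whole space this applies to balls. The tails are uniformly small: Hölder's inequality with `B
∈ L^{p*/(p*-q)}` and the Sobolev inequality bound them by the tail of the integral of
`B^{p*/(p*-q)}`.

All of this concerns test functions. The inequality extends to `W_A(Ω)` by Fatou's lemma, and
compactness by replacing each term of a sequence with a nearby test function
(`compact_embedding_of_isTest`). -/

open scoped NNReal

namespace WeightedSobolev

/-! ### Dilated averages from `L^p` to `L^q`. -/

section Averages

/-- Jensen's inequality for powers, on a space of arbitrary total mass. -/
theorem lintegral_rpow_le_measure_univ_rpow_mul {α : Type*} [MeasurableSpace α] {m : Measure α}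
    {f : α → ℝ≥0∞} (hf : AEMeasurable f m) {q : ℝ} (hq : 1 ≤ q) :
    (∫⁻ x, f x ∂m) ^ q ≤ m Set.univ ^ (q - 1) * ∫⁻ x, f x ^ q ∂m := by
  rcases hq.eq_or_lt with rfl | hq
  · simp
  have hc : q.HolderConjugate (q / (q - 1)) := Real.HolderConjugate.conjExponent hq
  have hq0 : 0 < q := by linarith
  have h := ENNReal.lintegral_mul_le_Lp_mul_Lq m hc hf (aemeasurable_const (b := (1 : ℝ≥0∞)))
  simp only [Pi.mul_apply, mul_one, ENNReal.one_rpow, lintegral_const, one_mul] at h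
  calc (∫⁻ x, f x ∂m) ^ q
      ≤ ((∫⁻ x, f x ^ q ∂m) ^ (1 / q) * m Set.univ ^ (1 / (q / (q - 1)))) ^ q :=
        ENNReal.rpow_le_rpow h hq0.le
    _ = m Set.univ ^ (q - 1) * ∫⁻ x, f x ^ q ∂m := by
        rw [ENNReal.mul_rpow_of_nonneg _ _ hq0.le, ← ENNReal.rpow_mul, ← ENNReal.rpow_mul,
          one_div_mul_cancel hq0.ne', ENNReal.rpow_one, mul_comm]
        congr 2
        field_simp

variable {E : Type*} [NormedAddCommGroup E] [NormedSpace ℝ E] [FiniteDimensional ℝ E]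
  [MeasurableSpace E] [BorelSpace E] {μ : Measure E} [μ.IsAddHaarMeasure]

theorem lintegral_comp_add_smul {f : E → ℝ≥0∞} (hf : Measurable f) (x : E) {t : ℝ} (ht : 0 < t) :
    ∫⁻ z, f (x + t • z) ∂μ =
      ENNReal.ofReal t ^ (-(Module.finrank ℝ E : ℝ)) * ∫⁻ z, f z ∂μ := by
  have h1 : ∫⁻ z, f (x + t • z) ∂μ = ∫⁻ z, f (x + z) ∂(μ.map (t • ·)) := by
    rw [lintegral_map (by fun_prop) (by fun_prop)]
  rw [h1, Measure.map_addHaar_smul μ ht.ne', lintegral_smul_measure, lintegral_add_left_eq_self f,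
    smul_eq_mul, abs_of_pos (by positivity), ENNReal.rpow_neg, ENNReal.rpow_natCast,
    ENNReal.ofReal_inv_of_pos (by positivity), ENNReal.ofReal_pow ht.le]

/-- A dilated average of an `L^p` function is in `L^q` for `q ≥ p`, with the scaling of the
dilation. -/
theorem lintegral_average_rpow_le {m : Measure E} [IsProbabilityMeasure m] {M : ℝ≥0∞}
    (hm : m ≤ M • μ) {g : E → ℝ≥0∞} (hg : Measurable g) {p q : ℝ} (hp : 1 ≤ p) (hpq : p ≤ q)
    {t : ℝ} (ht : 0 < t) :
    ∫⁻ x, (∫⁻ z, g (x + t • z) ∂m) ^ q ∂μ ≤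
      (M * ENNReal.ofReal t ^ (-(Module.finrank ℝ E : ℝ))) ^ (q / p - 1) *
        (∫⁻ x, g x ^ p ∂μ) ^ (q / p) := by
  set I := ∫⁻ x, g x ^ p ∂μ with hI
  set K := M * ENNReal.ofReal t ^ (-(Module.finrank ℝ E : ℝ)) with hK
  have hp0 : 0 < p := by linarith
  have hqp : 0 ≤ q / p - 1 := by
    rw [sub_nonneg, one_le_div hp0]; exact hpq
  -- The average of `g ^ p` dominates the `p`-th power of the average by Jensen. It is bounded by `K
  -- * I`, since `m` has density at most `M`, and has integral `I` by translation invariance.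
  -- Interpolating, `b ^ (q / p) ≤ (K * I) ^ (q / p - 1) * b`.
  set b : E → ℝ≥0∞ := fun x => ∫⁻ z, g (x + t • z) ^ p ∂m with hb
  have h1 : ∀ x, (∫⁻ z, g (x + t • z) ∂m) ^ p ≤ b x := fun x => by
    have := lintegral_rpow_le_measure_univ_rpow_mul (m := m) (f := fun z => g (x + t • z))
      (by fun_prop) hp
    simpa using this
  have h2 : ∀ x, b x ≤ K * I := fun x => by
    calc b x ≤ ∫⁻ z, g (x + t • z) ^ p ∂(M • μ) := lintegral_mono' hm le_rfl
      _ = K * I := by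
        rw [lintegral_smul_measure, lintegral_comp_add_smul (f := fun y => g y ^ p)
          (by fun_prop) x ht, smul_eq_mul, hK, mul_assoc]
  have h3 : ∫⁻ x, b x ∂μ = I := by
    rw [hb, lintegral_lintegral_swap (by fun_prop)]
    simp_rw [lintegral_add_right_eq_self (μ := μ) (fun y => g y ^ p)]
    simp [hI]
  have hbm : Measurable b := by
    apply Measurable.lintegral_prod_right' (f := fun y : E × E => g (y.1 + t • y.2) ^ p)
    fun_prop
  calc ∫⁻ x, (∫⁻ z, g (x + t • z) ∂m) ^ q ∂μ
      ≤ ∫⁻ x, (K * I) ^ (q / p - 1) * b x ∂μ := by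
        refine lintegral_mono fun x => ?_
        calc (∫⁻ z, g (x + t • z) ∂m) ^ q
            = ((∫⁻ z, g (x + t • z) ∂m) ^ p) ^ (q / p) := by
              rw [← ENNReal.rpow_mul]; congr 1; field_simp
          _ ≤ b x ^ (q / p) := ENNReal.rpow_le_rpow (h1 x) (by linarith)
          _ = b x ^ (q / p - 1) * b x := by
              conv_rhs => rw [← ENNReal.rpow_one (b x), ← ENNReal.rpow_mul, one_mul]
              rw [← ENNReal.rpow_add_of_nonneg _ _ hqp zero_le_one, sub_add_cancel]
          _ ≤ (K * I) ^ (q / p - 1) * b x := by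
              gcongr
              exact h2 x
    _ = (K * I) ^ (q / p - 1) * I := by rw [lintegral_const_mul _ hbm, h3]
    _ = K ^ (q / p - 1) * I ^ (q / p) := by
        rw [ENNReal.mul_rpow_of_nonneg _ _ hqp, mul_assoc]
        congr 1
        conv_lhs => rw [← ENNReal.rpow_one I, ← ENNReal.rpow_mul, one_mul]
        rw [← ENNReal.rpow_add_of_nonneg _ _ hqp zero_le_one, sub_add_cancel]

theorem lintegral_Ioo_rpow_lt_top {s : ℝ} (hs : -1 < s) :
    ∫⁻ t in Set.Ioo (0 : ℝ) 1, ENNReal.ofReal t ^ s < ⊤ := by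
  have h := ((intervalIntegral.integrableOn_Ioo_rpow_iff (s := s) one_pos).2 hs).2
  refine lt_of_le_of_lt (setLIntegral_mono_ae' measurableSet_Ioo ?_) h
  refine .of_forall fun t ht => ?_
  rw [ENNReal.ofReal_rpow_of_pos ht.1]
  exact Real.ofReal_le_enorm _

/-- The averages over segments `x + [0, h] z` of an `L^p` function, in the subcritical range. -/
theorem exists_lintegral_segment_average_rpow_le {m : Measure E} [IsProbabilityMeasure m]
    {M : ℝ≥0∞} (hM : M ≠ ⊤) (hm : m ≤ M • μ) {p q : ℝ} (hp : 1 ≤ p) (hpq : p ≤ q)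
    (hq : Module.finrank ℝ E * (q / p - 1) < q) :
    ∃ C : ℝ≥0∞, C ≠ ⊤ ∧ ∀ g : E → ℝ≥0∞, Measurable g → ∀ h : ℝ, 0 < h →
      ∫⁻ x, (∫⁻ t in Set.Ioo (0 : ℝ) 1, ∫⁻ z, g (x + (h * t) • z) ∂m) ^ q ∂μ ≤
        C * ENNReal.ofReal h ^ (-(Module.finrank ℝ E * (q / p - 1))) *
          (∫⁻ x, g x ^ p ∂μ) ^ (q / p) := by
  set κ : ℝ := Module.finrank ℝ E * (q / p - 1) with hκ
  have hp0 : 0 < p := by linarith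
  have hq0 : 0 < q := by linarith
  have hqp : 0 ≤ q / p - 1 := by
    rw [sub_nonneg, one_le_div hp0]; exact hpq
  -- Jensen in `t` is applied for the weight `t ^ (-β)`, integrable on `(0, 1)` because `β < 1`. The
  -- compensating factor `t ^ β`, raised to the power `q`, is `t ^ κ`, which cancels the singularity
  -- `t ^ (-κ)` of the average at dilation `h * t`.
  set β : ℝ := κ / q with hβ
  have hβ1 : β < 1 := by rw [hβ, div_lt_one hq0]; exact hq
  have hβκ : β * q = κ := div_mul_cancel₀ _ hq0.ne'
  set w : ℝ → ℝ≥0∞ := fun t => ENNReal.ofReal t ^ (-β) with hw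
  have hwm : Measurable w := by fun_prop
  set I01 := (volume : Measure ℝ).restrict (Set.Ioo 0 1) with hI01
  set ν := I01.withDensity w with hν
  set c := ∫⁻ t, w t ∂I01 with hc
  have hνc : ν Set.univ = c := by
    rw [hν, withDensity_apply _ MeasurableSet.univ, Measure.restrict_univ]
  have hct : c ≠ ⊤ := (lintegral_Ioo_rpow_lt_top (s := -β) (by linarith)).ne
  refine ⟨c ^ (q - 1) * M ^ (q / p - 1) * c, ?_, fun g hg h hh => ?_⟩
  · exact ENNReal.mul_ne_top (ENNReal.mul_ne_top (ENNReal.rpow_ne_top_of_nonneg (by linarith) hct)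
      (ENNReal.rpow_ne_top_of_nonneg hqp hM)) hct
  set I := ∫⁻ x, g x ^ p ∂μ
  set a : ℝ → E → ℝ≥0∞ := fun t x => ∫⁻ z, g (x + (h * t) • z) ∂m with ha
  have ham : Measurable fun y : E × ℝ => a y.2 y.1 := by
    apply Measurable.lintegral_prod_right'
      (f := fun y : (E × ℝ) × E => g (y.1.1 + (h * y.1.2) • y.2))
    fun_prop
  have ham' : ∀ x, Measurable fun t => a t x := fun x =>
    ham.comp measurable_prodMk_left
  have hτ : ∀ t ∈ Set.Ioo (0 : ℝ) 1, ENNReal.ofReal t ≠ 0 := fun t ht => by simpa using ht.1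
  have h1 : ∀ x, ∫⁻ t, a t x ∂I01 = ∫⁻ t, ENNReal.ofReal t ^ β * a t x ∂ν := fun x => by
    have hm1 : Measurable fun t => ENNReal.ofReal t ^ β * a t x := by
      have := ham' x; fun_prop
    rw [hν, lintegral_withDensity_eq_lintegral_mul _ hwm hm1]
    refine setLIntegral_congr_fun measurableSet_Ioo fun t ht => ?_
    simp only [Pi.mul_apply, hw]
    rw [← mul_assoc, ← ENNReal.rpow_add _ _ (hτ t ht) ENNReal.ofReal_ne_top]
    simp
  have h2 : ∀ x, (∫⁻ t, a t x ∂I01) ^ q ≤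
      c ^ (q - 1) * ∫⁻ t, w t * (ENNReal.ofReal t ^ κ * a t x ^ q) ∂I01 := fun x => by
    rw [h1]
    refine (lintegral_rpow_le_measure_univ_rpow_mul (by have := ham' x; fun_prop)
      (hp.trans hpq)).trans (le_of_eq ?_)
    have hm1 : Measurable fun t => (ENNReal.ofReal t ^ β * a t x) ^ q := by
      have := ham' x; fun_prop
    rw [hνc, hν, lintegral_withDensity_eq_lintegral_mul _ hwm hm1]
    congr 1
    refine lintegral_congr fun t => ?_
    simp only [Pi.mul_apply]
    rw [ENNReal.mul_rpow_of_nonneg _ _ hq0.le, ← ENNReal.rpow_mul, hβκ]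
  calc ∫⁻ x, (∫⁻ t, a t x ∂I01) ^ q ∂μ
      ≤ ∫⁻ x, c ^ (q - 1) * ∫⁻ t, w t * (ENNReal.ofReal t ^ κ * a t x ^ q) ∂I01 ∂μ :=
        lintegral_mono h2
    _ = c ^ (q - 1) * ∫⁻ t, ∫⁻ x, w t * (ENNReal.ofReal t ^ κ * a t x ^ q) ∂μ ∂I01 := by
        rw [lintegral_const_mul _ (by
          apply Measurable.lintegral_prod_right'
            (f := fun y : E × ℝ => w y.2 * (ENNReal.ofReal y.2 ^ κ * a y.2 y.1 ^ q))
          fun_prop), lintegral_lintegral_swap (by unfold Function.uncurry; fun_prop)]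
    _ ≤ c ^ (q - 1) * ∫⁻ t, w t *
          (M ^ (q / p - 1) * ENNReal.ofReal h ^ (-κ) * I ^ (q / p)) ∂I01 := by
        gcongr c ^ (q - 1) * ?_
        refine setLIntegral_mono' measurableSet_Ioo fun t ht => ?_
        have hatm : Measurable (a t) := ham.comp measurable_prodMk_right
        rw [lintegral_const_mul _ (by fun_prop), lintegral_const_mul _ (by fun_prop)]
        gcongr w t * ?_
        refine (mul_le_mul_right (lintegral_average_rpow_le hm hg hp hpq (mul_pos hh ht.1))
          _).trans (le_of_eq ?_)
        rw [ENNReal.mul_rpow_of_nonneg _ _ hqp, ← ENNReal.rpow_mul, neg_mul, ← hκ,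
          ENNReal.ofReal_mul hh.le,
          ENNReal.mul_rpow_of_ne_top ENNReal.ofReal_ne_top ENNReal.ofReal_ne_top]
        have : ENNReal.ofReal t ^ κ * ENNReal.ofReal t ^ (-κ) = 1 := by
          rw [← ENNReal.rpow_add _ _ (hτ t ht) ENNReal.ofReal_ne_top]; simp
        calc _ = (ENNReal.ofReal t ^ κ * ENNReal.ofReal t ^ (-κ)) *
              (M ^ (q / p - 1) * ENNReal.ofReal h ^ (-κ) * I ^ (q / p)) := by ring
          _ = _ := by rw [this, one_mul]
    _ = _ := by
        rw [lintegral_mul_const _ hwm]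
        ring

end Averages

theorem eLpNorm_ofReal_eq {α F : Type*} [MeasurableSpace α] [NormedAddCommGroup F]
    {μ : Measure α} (f : α → F) {q : ℝ} (hq : 0 < q) :
    eLpNorm f (ENNReal.ofReal q) μ = (∫⁻ x, ‖f x‖ₑ ^ q ∂μ) ^ (1 / q) := by
  rw [eLpNorm_eq_lintegral_rpow_enorm_toReal (by simpa using hq) ENNReal.ofReal_ne_top,
    ENNReal.toReal_ofReal hq.le]

theorem withDensity_ofReal_le {α : Type*} [MeasurableSpace α] (μ : Measure α) {η : α → ℝ} {M : ℝ}
    (hM : ∀ z, η z ≤ M) :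
    μ.withDensity (fun z => ENNReal.ofReal (η z)) ≤ ENNReal.ofReal M • μ := by
  rw [← withDensity_const]
  exact withDensity_mono (.of_forall fun z => ENNReal.ofReal_le_ofReal (hM z))

/-! ### Smooth functions and their averages at scale `h`. -/

section Kernel

variable {E : Type*} [NormedAddCommGroup E] [NormedSpace ℝ E]
  [MeasurableSpace E] {μ : Measure E}

/-- A Lipschitz probability density supported in the ball of radius `R`. -/
structure IsAveragingKernel (μ : Measure E) (η : E → ℝ) (R : ℝ) : Prop where
  nonneg : ∀ z, 0 ≤ η z
  lipschitz : ∃ K, LipschitzWith K η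
  norm_le : ∀ z, η z ≠ 0 → ‖z‖ ≤ R
  integral_eq_one : ∫ z, η z ∂μ = 1

/-- `Ω` contains every half-open segment from a point `x` of `S` to `x + z` with `η z ≠ 0`. -/
def IsConePiece (η : E → ℝ) (Ω S : Set E) : Prop :=
  ∀ x ∈ S, ∀ z, η z ≠ 0 → ∀ t ∈ Set.Ioc (0 : ℝ) 1, x + t • z ∈ Ω

/-- The average of `φ` around `x` at scale `h`, with density `η`. -/
noncomputable def scaleAverage (μ : Measure E) (η : E → ℝ) (h : ℝ) (φ : E → ℝ) (x : E) : ℝ :=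
  ∫ z, η z * φ (x + h • z) ∂μ

namespace IsAveragingKernel

variable {η : E → ℝ} {R : ℝ}

omit [NormedSpace ℝ E] in
theorem continuous (hη : IsAveragingKernel μ η R) : Continuous η :=
  hη.lipschitz.choose_spec.continuous

theorem hasCompactSupport [FiniteDimensional ℝ E] (hη : IsAveragingKernel μ η R) :
    HasCompactSupport η := by
  have := FiniteDimensional.proper ℝ E
  refine HasCompactSupport.intro (isCompact_closedBall (0 : E) R) fun z hz => ?_
  by_contra h
  exact hz (by simpa using hη.norm_le z h)

theorem exists_bound [FiniteDimensional ℝ E] (hη : IsAveragingKernel μ η R) :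
    ∃ M : ℝ, 0 < M ∧ ∀ z, η z ≤ M := by
  obtain ⟨C, hC⟩ := hη.hasCompactSupport.exists_bound_of_continuous hη.continuous
  exact ⟨max C 1, by positivity, fun z => (le_abs_self _).trans ((hC z).trans (le_max_left _ _))⟩

variable [FiniteDimensional ℝ E] [BorelSpace E] [μ.IsAddHaarMeasure]

theorem integrable (hη : IsAveragingKernel μ η R) : Integrable η μ :=
  hη.continuous.integrable_of_hasCompactSupport hη.hasCompactSupport

theorem isProbabilityMeasure (hη : IsAveragingKernel μ η R) :
    IsProbabilityMeasure (μ.withDensity fun z => ENNReal.ofReal (η z)) := by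
  constructor
  rw [withDensity_apply _ MeasurableSet.univ, Measure.restrict_univ,
    ← ofReal_integral_eq_lintegral_ofReal hη.integrable (.of_forall hη.nonneg),
    hη.integral_eq_one, ENNReal.ofReal_one]

end IsAveragingKernel

theorem enorm_sub_le_lintegral_segment [BorelSpace E] {φ : E → ℝ} (hφ : ContDiff ℝ 1 φ) (x v : E) :
    ‖φ x - φ (x + v)‖ₑ ≤ ‖v‖ₑ * ∫⁻ t in Set.Ioo (0 : ℝ) 1, ‖fderiv ℝ φ (x + t • v)‖ₑ := by
  have hd : ∀ t : ℝ, HasDerivAt (fun t : ℝ => φ (x + t • v)) (fderiv ℝ φ (x + t • v) v) t :=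
    fun t => by
    have h1 : HasDerivAt (fun t : ℝ => x + t • v) v t := by
      simpa using ((hasDerivAt_id t).smul_const v).const_add x
    exact ((hφ.differentiable one_ne_zero _).hasFDerivAt).comp_hasDerivAt t h1
  have hcf : Continuous (fderiv ℝ φ) := hφ.continuous_fderiv one_ne_zero
  have hc : Continuous fun t : ℝ => fderiv ℝ φ (x + t • v) v := by fun_prop
  have h := intervalIntegral.integral_eq_sub_of_hasDerivAt (a := 0) (b := 1) (fun t _ => hd t)
    (hc.intervalIntegrable _ _)
  simp only [one_smul, zero_smul, add_zero] at h
  rw [← neg_sub, enorm_neg, ← h, intervalIntegral.integral_of_le zero_le_one,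
    integral_Ioc_eq_integral_Ioo]
  refine (enorm_integral_le_lintegral_enorm _).trans ?_
  rw [← lintegral_const_mul' _ _ enorm_ne_top]
  refine lintegral_mono fun t => ?_
  rw [mul_comm]
  exact ContinuousLinearMap.le_opENorm _ _

variable [FiniteDimensional ℝ E] [BorelSpace E] [μ.IsAddHaarMeasure] {η : E → ℝ} {R : ℝ}

theorem IsAveragingKernel.integrable_mul_comp (hη : IsAveragingKernel μ η R) {φ : E → ℝ}
    (hφ : Continuous φ) (x : E) (h : ℝ) : Integrable (fun z => η z * φ (x + h • z)) μ := by
  have := hη.continuous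
  exact Continuous.integrable_of_hasCompactSupport (by fun_prop) hη.hasCompactSupport.mul_right

/-- Since `η` has mass one, the left side is the average of `φ x - φ (x + h • z)`, and each
difference is at most `h ‖z‖ ≤ h R` times the mean of the gradient along the segment. The cone
condition keeps the segment in `Ω`, so the gradient may be cut off outside `Ω`; this makes the bound
local. -/
theorem enorm_sub_scaleAverage_le (hη : IsAveragingKernel μ η R) {Ω S : Set E}
    (hS : IsConePiece η Ω S) (hΩ : MeasurableSet Ω) {φ : E → ℝ} (hφ : ContDiff ℝ 1 φ) {h : ℝ}
    (hh : h ∈ Set.Ioc (0 : ℝ) 1) {x : E} (hx : x ∈ S) :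
    ‖φ x - scaleAverage μ η h φ x‖ₑ ≤ ENNReal.ofReal (h * R) *
      ∫⁻ t in Set.Ioo (0 : ℝ) 1, ∫⁻ z, Ω.indicator (fun y => ‖fderiv ℝ φ y‖ₑ) (x + (h * t) • z)
        ∂(μ.withDensity fun z => ENNReal.ofReal (η z)) := by
  have := hη.isProbabilityMeasure
  set m := μ.withDensity fun z => ENNReal.ofReal (η z) with hm
  set g : E → ℝ≥0∞ := Ω.indicator fun y => ‖fderiv ℝ φ y‖ₑ with hg
  have hcf : Continuous (fderiv ℝ φ) := hφ.continuous_fderiv one_ne_zero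
  have hgm : Measurable g := hcf.measurable.enorm.indicator hΩ
  have hηm : Measurable fun z => ENNReal.ofReal (η z) := hη.continuous.measurable.ennreal_ofReal
  have h1 : φ x - scaleAverage μ η h φ x = ∫ z, η z * (φ x - φ (x + h • z)) ∂μ := by
    simp_rw [mul_sub]
    rw [integral_sub (hη.integrable.mul_const _) (hη.integrable_mul_comp hφ.continuous x h),
      integral_mul_const, hη.integral_eq_one, one_mul, scaleAverage]
  have h2 : ∀ z, ‖η z * (φ x - φ (x + h • z))‖ₑ ≤ ENNReal.ofReal (η z) *
      (ENNReal.ofReal (h * R) * ∫⁻ t in Set.Ioo (0 : ℝ) 1, g (x + (h * t) • z)) := fun z => by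
    rw [enorm_mul, Real.enorm_of_nonneg (hη.nonneg z)]
    by_cases hz : η z = 0
    · simp [hz]
    gcongr ENNReal.ofReal (η z) * ?_
    refine (enorm_sub_le_lintegral_segment hφ x (h • z)).trans ?_
    gcongr ?_ * ?_
    · rw [← ofReal_norm, norm_smul, Real.norm_of_nonneg hh.1.le]
      gcongr
      · exact hh.1.le
      · exact hη.norm_le z hz
    · refine setLIntegral_mono' measurableSet_Ioo fun t ht => le_of_eq ?_
      have hmem : x + (h * t) • z ∈ Ω :=
        hS x hx z hz _ ⟨mul_pos hh.1 ht.1, by nlinarith [hh.1, hh.2, ht.1, ht.2]⟩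
      rw [hg, Set.indicator_of_mem hmem, smul_smul, mul_comm t h]
  have hm1 : Measurable fun z => ∫⁻ t in Set.Ioo (0 : ℝ) 1, g (x + (h * t) • z) := by
    apply Measurable.lintegral_prod_right' (f := fun y : E × ℝ => g (x + (h * y.2) • y.1))
    fun_prop
  rw [h1]
  refine (enorm_integral_le_lintegral_enorm _).trans ((lintegral_mono h2).trans (le_of_eq ?_))
  have h3 := lintegral_withDensity_eq_lintegral_mul μ hηm
    (hm1.const_mul (ENNReal.ofReal (h * R)))
  simp only [Pi.mul_apply] at h3
  rw [← h3, lintegral_const_mul _ hm1]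
  congr 1
  rw [lintegral_lintegral_swap (by unfold Function.uncurry; fun_prop)]

/-- Smooth functions are close to their averages at scale `h` in the subcritical `L^q`, on the
part of the domain where the averages make sense. -/
theorem exists_eLpNorm_sub_scaleAverage_le (hη : IsAveragingKernel μ η R) {p q : ℝ} (hp : 1 ≤ p)
    (hpq : p ≤ q) (hq : Module.finrank ℝ E * (q / p - 1) < q) :
    ∃ (C : ℝ≥0∞) (θ : ℝ), C ≠ ⊤ ∧ 0 < θ ∧ ∀ Ω S : Set E, IsConePiece η Ω S → MeasurableSet Ω →
      MeasurableSet S → ∀ φ : E → ℝ, ContDiff ℝ 1 φ → ∀ h ∈ Set.Ioc (0 : ℝ) 1,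
        eLpNorm (φ - scaleAverage μ η h φ) (ENNReal.ofReal q) (μ.restrict S) ≤
          C * ENNReal.ofReal h ^ θ *
            eLpNorm (fderiv ℝ φ) (ENNReal.ofReal p) (μ.restrict Ω) := by
  have := hη.isProbabilityMeasure
  obtain ⟨M, -, hM⟩ := hη.exists_bound
  obtain ⟨C, hC, hCb⟩ := exists_lintegral_segment_average_rpow_le (ENNReal.ofReal_ne_top (r := M))
    (withDensity_ofReal_le μ hM) hp hpq hq
  have hp0 : 0 < p := by linarith
  have hq0 : 0 < q := by linarith
  set κ : ℝ := Module.finrank ℝ E * (q / p - 1) with hκ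
  -- The length of the segments contributes one power of `h` and the averaging costs `h ^ (-κ / q)`.
  -- Subcriticality is exactly `κ < q`.
  refine ⟨ENNReal.ofReal R * C ^ (1 / q), 1 - κ / q, ?_, ?_, ?_⟩
  · exact ENNReal.mul_ne_top ENNReal.ofReal_ne_top (ENNReal.rpow_ne_top_of_nonneg (by positivity) hC)
  · rw [sub_pos, div_lt_one hq0]; exact hq
  intro Ω S hS hΩ hSm φ hφ h hh
  have hcf : Continuous (fderiv ℝ φ) := hφ.continuous_fderiv one_ne_zero
  set g : E → ℝ≥0∞ := Ω.indicator fun y => ‖fderiv ℝ φ y‖ₑ with hg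
  have hgm : Measurable g := hcf.measurable.enorm.indicator hΩ
  have hgp : ∫⁻ x, g x ^ p ∂μ = ∫⁻ x in Ω, ‖fderiv ℝ φ x‖ₑ ^ p ∂μ := by
    rw [← lintegral_indicator hΩ]
    refine lintegral_congr fun x => ?_
    by_cases hx : x ∈ Ω
    · simp [hg, hx]
    · simp [hg, hx, hp0]
  rw [eLpNorm_ofReal_eq _ hq0, eLpNorm_ofReal_eq _ hp0]
  have hR : ENNReal.ofReal (h * R) = ENNReal.ofReal h * ENNReal.ofReal R :=
    ENNReal.ofReal_mul hh.1.le
  have hh0 : ENNReal.ofReal h ≠ 0 := by simpa using hh.1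
  calc (∫⁻ x in S, ‖(φ - scaleAverage μ η h φ) x‖ₑ ^ q ∂μ) ^ (1 / q)
      ≤ (ENNReal.ofReal (h * R) ^ q * (C * ENNReal.ofReal h ^ (-κ) *
          (∫⁻ x, g x ^ p ∂μ) ^ (q / p))) ^ (1 / q) := by
        gcongr
        refine le_trans ?_ (mul_le_mul_right (hCb g hgm h hh.1) _)
        rw [← lintegral_const_mul' _ _
          (ENNReal.rpow_ne_top_of_nonneg hq0.le ENNReal.ofReal_ne_top)]
        refine (setLIntegral_mono' hSm fun x hx => ?_).trans (setLIntegral_le_lintegral S _)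
        rw [← ENNReal.mul_rpow_of_nonneg _ _ hq0.le]
        gcongr
        exact enorm_sub_scaleAverage_le hη hS hΩ hφ hh hx
    _ = _ := by
        rw [hgp, ENNReal.mul_rpow_of_nonneg _ _ (by positivity),
          ENNReal.mul_rpow_of_nonneg _ _ (by positivity),
          ENNReal.mul_rpow_of_nonneg _ _ (by positivity), ← ENNReal.rpow_mul, ← ENNReal.rpow_mul,
          ← ENNReal.rpow_mul, mul_one_div_cancel hq0.ne', ENNReal.rpow_one, hR,
          show q / p * (1 / q) = 1 / p by field_simp, sub_eq_add_neg,
          ENNReal.rpow_add _ _ hh0 ENNReal.ofReal_ne_top, ENNReal.rpow_one,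
          show -κ * (1 / q) = -(κ / q) by ring]
        ring

end Kernel

/-- A countable family of sequences of uniformly bounded and uniformly Lipschitz functions on a
separable space has a common subsequence that is pointwise Cauchy. -/
theorem exists_subseq_forall_cauchySeq {X J : Type*} [PseudoMetricSpace X]
    [TopologicalSpace.SeparableSpace X] [Countable J] (F : J → ℕ → X → ℝ)
    (hb : ∀ j, ∃ M : ℝ, ∀ n x, ‖F j n x‖ ≤ M) (hl : ∀ j, ∃ K, ∀ n, LipschitzWith K (F j n)) :
    ∃ σ : ℕ → ℕ, StrictMono σ ∧ ∀ j x, CauchySeq fun n => F j (σ n) x := by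
  rcases isEmpty_or_nonempty X with hX | hX
  · exact ⟨id, strictMono_id, fun _ x => (hX.false x).elim⟩
  choose M hM using hb
  choose K hK using hl
  -- Tychonoff replaces the diagonal argument: the values at all indices `j` and all points of a
  -- dense sequence lie in a countable product of compact intervals, which is sequentially compact.
  -- Equicontinuity then carries the Cauchy property to every point.
  have hcomp : IsCompact (Set.univ.pi fun y : J × ℕ => Set.Icc (-M y.1) (M y.1)) :=
    isCompact_univ_pi fun _ => isCompact_Icc
  obtain ⟨a, -, σ, hσ, ha⟩ := hcomp.tendsto_subseq
    (x := fun n y => F y.1 n (TopologicalSpace.denseSeq X y.2))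
    (fun n y _ => abs_le.1 (hM y.1 n _))
  refine ⟨σ, hσ, fun j x => Metric.cauchySeq_iff'.2 fun ε hε => ?_⟩
  have hδ : 0 < ε / (4 * (K j + 1)) := by positivity
  obtain ⟨_, hy, k, rfl⟩ := Metric.dense_iff.1 (TopologicalSpace.denseRange_denseSeq X) x _ hδ
  have hK1 : (K j : ℝ) * dist x (TopologicalSpace.denseSeq X k) ≤ ε / 4 := by
    rw [Metric.mem_ball, dist_comm, lt_div_iff₀ (by positivity)] at hy
    nlinarith [dist_nonneg (x := x) (y := TopologicalSpace.denseSeq X k)]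
  have hc : CauchySeq fun n => F j (σ n) (TopologicalSpace.denseSeq X k) :=
    ((tendsto_pi_nhds.1 ha) (j, k)).cauchySeq
  obtain ⟨n₀, hn₀⟩ := Metric.cauchySeq_iff'.1 hc (ε / 4) (by positivity)
  refine ⟨n₀, fun n hn => ?_⟩
  have h1 := (hK j (σ n)).dist_le_mul x (TopologicalSpace.denseSeq X k)
  have h2 := (hK j (σ n₀)).dist_le_mul x (TopologicalSpace.denseSeq X k)
  have h3 := hn₀ n hn
  have h4 := dist_triangle4 (F j (σ n) x) (F j (σ n) (TopologicalSpace.denseSeq X k))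
    (F j (σ n₀) (TopologicalSpace.denseSeq X k)) (F j (σ n₀) x)
  rw [dist_comm (F j (σ n₀) (TopologicalSpace.denseSeq X k))] at h4
  linarith

/-! ### Local compactness and the local Sobolev inequality. -/

section Compactness

variable {E : Type*} [NormedAddCommGroup E] [NormedSpace ℝ E]
  [MeasurableSpace E] {μ : Measure E}

/-- The integral of `φ` over `U` against the kernel `η` translated to `x` and dilated by `h`. -/
noncomputable def kernelPairing (μ : Measure E) (η : E → ℝ) (h : ℝ) (U : Set E) (φ : E → ℝ)
    (x : E) : ℝ :=
  ∫ w in U, η (h⁻¹ • (w - x)) * φ w ∂μ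

variable [FiniteDimensional ℝ E] [BorelSpace E] [μ.IsAddHaarMeasure] {η : E → ℝ} {R : ℝ}

/-- Substitute `w = x + h • z`; for `x ∈ S` the cone condition makes the kernel vanish off `U`.
Unlike the average, the pairing is controlled by `φ` on `U` alone for every `x`, which is what the
equicontinuity argument needs. -/
theorem scaleAverage_eq_kernelPairing {U S : Set E} (hS : IsConePiece η U S) (φ : E → ℝ) {h : ℝ}
    (hh : h ∈ Set.Ioc (0 : ℝ) 1) {x : E} (hx : x ∈ S) :
    scaleAverage μ η h φ x = (h ^ Module.finrank ℝ E)⁻¹ * kernelPairing μ η h U φ x := by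
  have hh0 : h ≠ 0 := hh.1.ne'
  have h1 : kernelPairing μ η h U φ x = ∫ w, η (h⁻¹ • (w - x)) * φ w ∂μ := by
    refine setIntegral_eq_integral_of_forall_compl_eq_zero fun w hw => ?_
    by_contra hne
    refine hw ?_
    have := hS x hx (h⁻¹ • (w - x)) (left_ne_zero_of_mul hne) h hh
    rwa [smul_inv_smul₀ hh0, add_sub_cancel] at this
  have h2 := Measure.integral_comp_smul μ
    (fun z => η (h⁻¹ • ((x + z) - x)) * φ (x + z)) h
  simp only [add_sub_cancel_left, inv_smul_smul₀ hh0] at h2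
  have h3 := integral_add_left_eq_self (μ := μ) (fun w => η (h⁻¹ • (w - x)) * φ w) x
  simp only [add_sub_cancel_left] at h3
  rw [scaleAverage, h2, h1, ← h3, abs_of_pos (inv_pos.2 (pow_pos hh.1 _)), smul_eq_mul]

omit [FiniteDimensional ℝ E] [BorelSpace E] [μ.IsAddHaarMeasure] in
theorem IsAveragingKernel.enorm_kernelPairing_le (hη : IsAveragingKernel μ η R) {M : ℝ}
    (hM : ∀ z, η z ≤ M) (h : ℝ) (U : Set E) (φ : E → ℝ) (x : E) :
    ‖kernelPairing μ η h U φ x‖ₑ ≤ ENNReal.ofReal M * eLpNorm φ 1 (μ.restrict U) := by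
  refine (enorm_integral_le_lintegral_enorm _).trans ?_
  rw [eLpNorm_one_eq_lintegral_enorm, ← lintegral_const_mul' _ _ ENNReal.ofReal_ne_top]
  refine lintegral_mono fun w => ?_
  rw [enorm_mul, Real.enorm_of_nonneg (hη.nonneg _)]
  gcongr
  exact hM _

omit [FiniteDimensional ℝ E] [μ.IsAddHaarMeasure] in
-- All the regularity in `x` comes from `η`; of `φ` only the `L¹(U)` norm enters, so the constant is
-- uniform along an `L¹`-bounded sequence.
theorem lipschitzWith_kernelPairing {K L : ℝ≥0} (hK : LipschitzWith K η) {M : ℝ}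
    (hM : ∀ z, ‖η z‖ ≤ M) (h : ℝ) (U : Set E) {φ : E → ℝ}
    (hφ : AEStronglyMeasurable φ (μ.restrict U)) (hL : eLpNorm φ 1 (μ.restrict U) ≤ L) :
    LipschitzWith (K * ‖h⁻¹‖₊ * L) (kernelPairing μ η h U φ) := by
  intro x y
  have hint : Integrable φ (μ.restrict U) :=
    memLp_one_iff_integrable.1 ⟨hφ, hL.trans_lt ENNReal.coe_lt_top⟩
  have hηc := hK.continuous
  have hi : ∀ x, Integrable (fun w => η (h⁻¹ • (w - x)) * φ w) (μ.restrict U) := fun x =>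
    hint.bdd_mul (Continuous.aestronglyMeasurable (by fun_prop)) (.of_forall fun w => hM _)
  rw [edist_eq_enorm_sub, kernelPairing, kernelPairing, ← integral_sub (hi x) (hi y)]
  refine (enorm_integral_le_lintegral_enorm _).trans ?_
  have hp : ∀ w, ‖η (h⁻¹ • (w - x)) * φ w - η (h⁻¹ • (w - y)) * φ w‖ₑ ≤
      K * ‖h⁻¹‖₊ * edist x y * ‖φ w‖ₑ := fun w => by
    rw [← sub_mul, enorm_mul, ← edist_eq_enorm_sub]
    gcongr
    refine (hK _ _).trans ?_
    rw [mul_assoc, edist_eq_enorm_sub, ← smul_sub, enorm_smul, sub_sub_sub_cancel_left,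
      ← edist_eq_enorm_sub, edist_comm y x, enorm_eq_nnnorm]
  refine (lintegral_mono hp).trans ?_
  rw [lintegral_const_mul' _ _ (by finiteness), ← eLpNorm_one_eq_lintegral_enorm]
  push_cast
  calc _ ≤ K * ‖h⁻¹‖₊ * edist x y * (L : ℝ≥0∞) := by gcongr
    _ = _ := by ring

theorem tendsto_eLpNorm_sub_of_dominated {α : Type*} [MeasurableSpace α] {ν : Measure α}
    [IsFiniteMeasure ν] {f : ℕ → α → ℝ} (hf : ∀ n, AEStronglyMeasurable (f n) ν) {M : ℝ}
    (hM : ∀ n, ∀ᵐ x ∂ν, ‖f n x‖ ≤ M) (hc : ∀ᵐ x ∂ν, CauchySeq fun n => f n x) {q : ℝ}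
    (hq : 0 < q) :
    Tendsto (fun n : ℕ × ℕ => eLpNorm (f n.1 - f n.2) (ENNReal.ofReal q) ν) atTop (𝓝 0) := by
  simp_rw [eLpNorm_ofReal_eq _ hq]
  have h0 : (0 : ℝ≥0∞) = (∫⁻ _, 0 ∂ν) ^ (1 / q) := by simp [hq]
  rw [h0]
  refine Tendsto.ennrpow_const _ ?_
  refine tendsto_lintegral_filter_of_dominated_convergence' (fun _ => ENNReal.ofReal (M + M) ^ q)
    (.of_forall fun n => (((hf n.1).sub (hf n.2)).enorm.pow_const q)) (.of_forall fun n => ?_) ?_ ?_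
  · filter_upwards [hM n.1, hM n.2] with x h1 h2
    gcongr
    rw [← ofReal_norm]
    exact ENNReal.ofReal_le_ofReal ((norm_sub_le _ _).trans (add_le_add h1 h2))
  · rw [lintegral_const]
    exact ENNReal.mul_ne_top (ENNReal.rpow_ne_top_of_nonneg hq.le ENNReal.ofReal_ne_top)
      (measure_ne_top _ _)
  · filter_upwards [hc] with x hx
    have h1 := cauchySeq_iff_tendsto_dist_atTop_0.1 hx
    have h2 : Tendsto (fun n : ℕ × ℕ => ‖(f n.1 - f n.2) x‖ₑ) atTop (𝓝 0) := by
      have := ENNReal.tendsto_ofReal h1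
      simpa only [ENNReal.ofReal_zero, dist_eq_norm, ofReal_norm, Pi.sub_apply] using this
    simpa [hq] using h2.ennrpow_const q

/-- A sequence of smooth functions whose gradients are bounded in `L^p` and whose averages converge
at all scales is Cauchy in the subcritical `L^q`. -/
theorem tendsto_eLpNorm_sub_of_cauchySeq_kernelPairing (hη : IsAveragingKernel μ η R) {p q : ℝ}
    (hp : 1 ≤ p) (hpq : p ≤ q) (hq : Module.finrank ℝ E * (q / p - 1) < q) {U S : Set E}
    (hS : IsConePiece η U S) (hUm : MeasurableSet U) (hSm : MeasurableSet S) (hSf : μ S ≠ ⊤)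
    {φ : ℕ → E → ℝ} (hφ : ∀ n, ContDiff ℝ 1 (φ n)) {G L : ℝ≥0}
    (hG : ∀ n, eLpNorm (fderiv ℝ (φ n)) (ENNReal.ofReal p) (μ.restrict U) ≤ G)
    (hL : ∀ n, eLpNorm (φ n) 1 (μ.restrict U) ≤ L)
    (hc : ∀ (k : ℕ) (x : E), CauchySeq fun n => kernelPairing μ η (1 / ((k : ℝ) + 1)) U (φ n) x) :
    Tendsto (fun n : ℕ × ℕ => eLpNorm (φ n.1 - φ n.2) (ENNReal.ofReal q) (μ.restrict S))
      atTop (𝓝 0) := by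
  obtain ⟨C, θ, hC, hθ, hest⟩ := exists_eLpNorm_sub_scaleAverage_le (μ := μ) hη hp hpq hq
  obtain ⟨M, hM0, hM⟩ := hη.exists_bound
  have hq0 : 0 < q := by linarith
  have hq1 : 1 ≤ ENNReal.ofReal q := by
    rw [← ENNReal.ofReal_one]; exact ENNReal.ofReal_le_ofReal (hp.trans hpq)
  have : IsFiniteMeasure (μ.restrict S) := ⟨by simpa using hSf.lt_top⟩
  have hhk : ∀ k : ℕ, 1 / ((k : ℝ) + 1) ∈ Set.Ioc (0 : ℝ) 1 := fun k =>
    ⟨by positivity, by rw [div_le_one (by positivity)]; linarith [k.cast_nonneg (α := ℝ)]⟩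
  have hηc := hη.continuous
  have hTm : ∀ h n, AEStronglyMeasurable (scaleAverage μ η h (φ n)) (μ.restrict S) := by
    intro h n
    have hφc := (hφ n).continuous
    have : StronglyMeasurable fun x => ∫ z, η z * φ n (x + h • z) ∂μ := by
      apply StronglyMeasurable.integral_prod_right'
        (f := fun y : E × E => η y.2 * φ n (y.1 + h • y.2))
      exact Continuous.stronglyMeasurable (by fun_prop)
    exact this.aestronglyMeasurable
  have hT : ∀ k : ℕ, Tendsto (fun n : ℕ × ℕ =>
      eLpNorm (scaleAverage μ η (1 / ((k : ℝ) + 1)) (φ n.1) -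
        scaleAverage μ η (1 / ((k : ℝ) + 1)) (φ n.2)) (ENNReal.ofReal q) (μ.restrict S))
      atTop (𝓝 0) := by
    intro k
    set h := 1 / ((k : ℝ) + 1) with hh
    refine tendsto_eLpNorm_sub_of_dominated (fun n => hTm h n)
      (M := (h ^ Module.finrank ℝ E)⁻¹ * (M * L)) (fun n => ?_) ?_ hq0
    · refine (ae_restrict_iff' hSm).2 (.of_forall fun x hx => ?_)
      rw [scaleAverage_eq_kernelPairing hS _ (hhk k) hx, norm_mul,
        Real.norm_of_nonneg (inv_nonneg.2 (pow_nonneg (hhk k).1.le _))]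
      have h0 : 0 ≤ (h ^ Module.finrank ℝ E)⁻¹ := inv_nonneg.2 (pow_nonneg (hhk k).1.le _)
      gcongr
      have h1 := (hη.enorm_kernelPairing_le hM h U (φ n) x).trans
        (mul_le_mul_right (hL n) _)
      rw [← ofReal_norm, ← ENNReal.ofReal_coe_nnreal, ← ENNReal.ofReal_mul hM0.le] at h1
      exact (ENNReal.ofReal_le_ofReal_iff (by positivity)).1 h1
    · refine (ae_restrict_iff' hSm).2 (.of_forall fun x hx => ?_)
      rw [funext fun n => scaleAverage_eq_kernelPairing (μ := μ) hS (φ n) (hhk k) hx]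
      exact (uniformContinuous_const_smul ((h ^ Module.finrank ℝ E)⁻¹)).comp_cauchySeq (hc k x)
  have hsmall : Tendsto (fun k : ℕ => C * ENNReal.ofReal (1 / ((k : ℝ) + 1)) ^ θ * G)
      atTop (𝓝 0) := by
    have h1 : Tendsto (fun k : ℕ => ENNReal.ofReal (1 / ((k : ℝ) + 1)) ^ θ) atTop (𝓝 0) := by
      have := (ENNReal.tendsto_ofReal tendsto_one_div_add_atTop_nhds_zero_nat).ennrpow_const θ
      simpa [hθ] using this
    have h2 := ENNReal.Tendsto.mul_const (ENNReal.Tendsto.const_mul h1 (.inr hC))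
      (b := (G : ℝ≥0∞)) (.inr ENNReal.coe_ne_top)
    simpa using h2
  rw [ENNReal.tendsto_nhds_zero]
  intro ε hε
  have hε3 : 0 < ε / 3 := ENNReal.div_pos hε.ne' (by simp)
  -- The scale is fixed first, making `φ n` and its average `ε / 3`-close uniformly in `n`. At that
  -- scale the averages are Cauchy by dominated convergence, which handles the middle of three
  -- terms.
  obtain ⟨k, hk⟩ := (ENNReal.tendsto_nhds_zero.1 hsmall _ hε3).exists
  filter_upwards [ENNReal.tendsto_nhds_zero.1 (hT k) _ hε3] with n hn
  set h := 1 / ((k : ℝ) + 1) with hh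
  have hb : ∀ n, eLpNorm (φ n - scaleAverage μ η h (φ n)) (ENNReal.ofReal q) (μ.restrict S) ≤
      ε / 3 := fun n => (hest U S hS hUm hSm _ (hφ n) h (hhk k)).trans
        ((mul_le_mul_right (hG n) _).trans hk)
  have hφm : ∀ n, AEStronglyMeasurable (φ n) (μ.restrict S) := fun n =>
    (hφ n).continuous.aestronglyMeasurable
  have hdec : φ n.1 - φ n.2 = (φ n.1 - scaleAverage μ η h (φ n.1)) +
      (scaleAverage μ η h (φ n.1) - scaleAverage μ η h (φ n.2)) -
      (φ n.2 - scaleAverage μ η h (φ n.2)) := by abel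
  rw [hdec]
  calc _ ≤ ε / 3 + ε / 3 + ε / 3 :=
        (eLpNorm_sub_le (((hφm _).sub (hTm _ _)).add ((hTm _ _).sub (hTm _ _)))
          ((hφm _).sub (hTm _ _)) hq1).trans (add_le_add ((eLpNorm_add_le
            ((hφm _).sub (hTm _ _)) ((hTm _ _).sub (hTm _ _)) hq1).trans
              (add_le_add (hb _) hn)) (hb _))
    _ = ε := ENNReal.add_thirds ε

/-- The data of a bounded part `S` of an open set on which averages with density `η` only involve
the bounded set `U`. -/
structure IsAveragingPiece (μ : Measure E) (η : E → ℝ) (R : ℝ) (U S : Set E) : Prop where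
  kernel : IsAveragingKernel μ η R
  cone : IsConePiece η U S
  measurableSet_left : MeasurableSet U
  measurableSet_right : MeasurableSet S
  isBounded_left : Bornology.IsBounded U
  isBounded_right : Bornology.IsBounded S

theorem exists_subseq_tendsto_eLpNorm_sub {ι : Type*} [Countable ι] {η : ι → E → ℝ} {R : ι → ℝ}
    {U S : ι → Set E} (hP : ∀ i, IsAveragingPiece μ (η i) (R i) (U i) (S i)) {p q : ℝ}
    (hp : 1 ≤ p) (hpq : p ≤ q) (hq : Module.finrank ℝ E * (q / p - 1) < q)
    {φ : ℕ → E → ℝ} (hφ : ∀ n, ContDiff ℝ 1 (φ n))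
    (hG : ∀ i, ∃ G : ℝ≥0, ∀ n,
      eLpNorm (fderiv ℝ (φ n)) (ENNReal.ofReal p) (μ.restrict (U i)) ≤ G)
    (hL : ∀ i, ∃ L : ℝ≥0, ∀ n, eLpNorm (φ n) 1 (μ.restrict (U i)) ≤ L) :
    ∃ σ : ℕ → ℕ, StrictMono σ ∧ ∀ i, Tendsto (fun n : ℕ × ℕ =>
      eLpNorm (φ (σ n.1) - φ (σ n.2)) (ENNReal.ofReal q) (μ.restrict (S i))) atTop (𝓝 0) := by
  have := FiniteDimensional.proper ℝ E
  choose G hG using hG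
  choose L hL using hL
  obtain ⟨σ, hσ, hc⟩ := exists_subseq_forall_cauchySeq
    (fun (j : ι × ℕ) n => kernelPairing μ (η j.1) (1 / ((j.2 : ℝ) + 1)) (U j.1) (φ n))
    (fun j => by
      obtain ⟨M, hM0, hM⟩ := (hP j.1).kernel.exists_bound
      refine ⟨M * L j.1, fun n x => ?_⟩
      have h1 := ((hP j.1).kernel.enorm_kernelPairing_le hM (1 / ((j.2 : ℝ) + 1)) (U j.1)
        (φ n) x).trans (mul_le_mul_right (hL j.1 n) _)
      rw [← ofReal_norm, ← ENNReal.ofReal_coe_nnreal, ← ENNReal.ofReal_mul hM0.le] at h1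
      exact (ENNReal.ofReal_le_ofReal_iff (by positivity)).1 h1)
    (fun j => by
      obtain ⟨M, hM0, hM⟩ := (hP j.1).kernel.exists_bound
      obtain ⟨K, hK⟩ := (hP j.1).kernel.lipschitz
      refine ⟨K * ‖(1 / ((j.2 : ℝ) + 1))⁻¹‖₊ * L j.1, fun n => ?_⟩
      exact lipschitzWith_kernelPairing hK (fun z => by rw [Real.norm_of_nonneg ((hP j.1).kernel.nonneg z)]; exact hM z) _ _
        (hφ n).continuous.aestronglyMeasurable (hL j.1 n))
  refine ⟨σ, hσ, fun i => ?_⟩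
  exact tendsto_eLpNorm_sub_of_cauchySeq_kernelPairing (φ := fun n => φ (σ n))
    (G := G i) (L := L i) (hP i).kernel hp hpq hq
    (hP i).cone (hP i).measurableSet_left (hP i).measurableSet_right
    (hP i).isBounded_right.measure_lt_top.ne (fun n => hφ (σ n)) (fun n => hG i (σ n))
    (fun n => hL i (σ n)) (fun k x => hc (i, k) x)

/-- The local Sobolev inequality on an averaging piece. -/
theorem IsAveragingPiece.exists_eLpNorm_le {U S : Set E} (hP : IsAveragingPiece μ η R U S)
    {p q : ℝ} (hp : 1 ≤ p) (hpq : p ≤ q) (hq : Module.finrank ℝ E * (q / p - 1) < q) :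
    ∃ C : ℝ≥0∞, C ≠ ⊤ ∧ ∀ φ : E → ℝ, ContDiff ℝ 1 φ →
      eLpNorm φ (ENNReal.ofReal q) (μ.restrict S) ≤
        C * (eLpNorm (fderiv ℝ φ) (ENNReal.ofReal p) (μ.restrict U) +
          eLpNorm φ 1 (μ.restrict U)) := by
  have := FiniteDimensional.proper ℝ E
  obtain ⟨C, θ, hC, hθ, hest⟩ := exists_eLpNorm_sub_scaleAverage_le (μ := μ) hP.kernel hp hpq hq
  obtain ⟨M, hM0, hM⟩ := hP.kernel.exists_bound
  have hq0 : 0 < q := by linarith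
  have hq1 : 1 ≤ ENNReal.ofReal q := by
    rw [← ENNReal.ofReal_one]; exact ENNReal.ofReal_le_ofReal (hp.trans hpq)
  set D : ℝ≥0∞ := ENNReal.ofReal M * μ S ^ (1 / q) with hD
  have hDt : D ≠ ⊤ := ENNReal.mul_ne_top ENNReal.ofReal_ne_top
    (ENNReal.rpow_ne_top_of_nonneg (by positivity) hP.isBounded_right.measure_lt_top.ne)
  refine ⟨C + D, by finiteness, fun φ hφ => ?_⟩
  -- Scale one suffices for an inequality: the average itself is bounded on `S` by `M` times the
  -- `L¹(U)` norm, and `S` has finite measure.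
  have h1 := hest U S hP.cone hP.measurableSet_left hP.measurableSet_right φ hφ 1 (by simp)
  simp only [ENNReal.ofReal_one, ENNReal.one_rpow, mul_one] at h1
  have hηc := hP.kernel.continuous
  have hφc := hφ.continuous
  have hTm : AEStronglyMeasurable (scaleAverage μ η 1 φ) (μ.restrict S) := by
    have : StronglyMeasurable fun x => ∫ z, η z * φ (x + (1 : ℝ) • z) ∂μ := by
      apply StronglyMeasurable.integral_prod_right'
        (f := fun y : E × E => η y.2 * φ (y.1 + (1 : ℝ) • y.2))
      exact Continuous.stronglyMeasurable (by fun_prop)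
    exact this.aestronglyMeasurable
  have h2 : eLpNorm (scaleAverage μ η 1 φ) (ENNReal.ofReal q) (μ.restrict S) ≤
      D * eLpNorm φ 1 (μ.restrict U) := by
    rw [eLpNorm_ofReal_eq _ hq0]
    calc _ ≤ (∫⁻ _ in S, (ENNReal.ofReal M * eLpNorm φ 1 (μ.restrict U)) ^ q ∂μ) ^ (1 / q) := by
          gcongr ?_ ^ _
          refine setLIntegral_mono' hP.measurableSet_right fun x hx => ?_
          rw [scaleAverage_eq_kernelPairing hP.cone φ (by simp) hx]
          gcongr
          simpa using hP.kernel.enorm_kernelPairing_le hM 1 U φ x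
      _ = _ := by
          rw [setLIntegral_const, ENNReal.mul_rpow_of_nonneg _ _ (by positivity),
            ← ENNReal.rpow_mul, mul_one_div_cancel hq0.ne', ENNReal.rpow_one, hD]
          ring
  calc eLpNorm φ (ENNReal.ofReal q) (μ.restrict S)
      = eLpNorm ((φ - scaleAverage μ η 1 φ) + scaleAverage μ η 1 φ) (ENNReal.ofReal q)
          (μ.restrict S) := by rw [sub_add_cancel]
    _ ≤ _ := eLpNorm_add_le (hφc.aestronglyMeasurable.sub hTm) hTm hq1
    _ ≤ C * eLpNorm (fderiv ℝ φ) (ENNReal.ofReal p) (μ.restrict U) +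
          D * eLpNorm φ 1 (μ.restrict U) := add_le_add h1 h2
    _ ≤ _ := by
        rw [mul_add, add_mul, add_mul]
        gcongr
        · exact le_self_add
        · exact le_add_self

end Compactness

/-! ### Averaging pieces covering a `C¹` domain. -/

section

theorem exists_isAveragingKernel {E : Type*} [NormedAddCommGroup E] [InnerProductSpace ℝ E]
    [FiniteDimensional ℝ E] [MeasurableSpace E] [BorelSpace E] (μ : Measure E)
    [μ.IsAddHaarMeasure] (c : E) {ρ : ℝ} (hρ : 0 < ρ) :
    ∃ η : E → ℝ, IsAveragingKernel μ η (‖c‖ + ρ) ∧ ∀ z, η z ≠ 0 → ‖z - c‖ < ρ := by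
  let f : ContDiffBump c := ⟨ρ / 2, ρ, by positivity, by linarith⟩
  have hs : ∀ z, f.normed μ z ≠ 0 → ‖z - c‖ < ρ := fun z hz => by
    have : z ∈ Function.support (f.normed μ) := hz
    rw [f.support_normed_eq, mem_ball_iff_norm] at this
    exact this
  refine ⟨f.normed μ, ⟨fun z => f.nonneg_normed z, ?_, fun z hz => ?_, f.integral_normed⟩, hs⟩
  · exact (f.contDiff_normed (n := 1)).lipschitzWith_of_hasCompactSupport
      f.hasCompactSupport_normed one_ne_zero
  · have h1 := hs z hz
    have h2 := norm_add_le c (z - c)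
    rw [add_sub_cancel] at h2
    linarith

variable {N : ℕ} {Ω : Set (EuclideanSpace ℝ (Fin N))}

theorem exists_isAveragingPiece_of_mem (hΩ : IsOpen Ω) (hb : Bornology.IsBounded Ω)
    {x₀ : EuclideanSpace ℝ (Fin N)} (hx₀ : x₀ ∈ Ω) :
    ∃ (δ : ℝ) (η : EuclideanSpace ℝ (Fin N) → ℝ) (R : ℝ), 0 < δ ∧
      IsAveragingPiece volume η R Ω (Ω ∩ Metric.ball x₀ δ) := by
  obtain ⟨r, hr, hrΩ⟩ := Metric.isOpen_iff.1 hΩ x₀ hx₀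
  obtain ⟨η, hη, hηs⟩ := exists_isAveragingKernel volume (0 : EuclideanSpace ℝ (Fin N))
    (ρ := r / 2) (by positivity)
  refine ⟨r / 2, η, _, by positivity, hη, ?_, hΩ.measurableSet,
    hΩ.measurableSet.inter measurableSet_ball, hb, hb.subset Set.inter_subset_left⟩
  rintro x ⟨-, hx⟩ z hz t ⟨ht0, ht1⟩
  apply hrΩ
  have h1 := hηs z hz
  rw [sub_zero] at h1
  rw [mem_ball_iff_norm] at hx ⊢
  have h2 := norm_add_le (x - x₀) (t • z)
  rw [norm_smul, Real.norm_of_nonneg ht0.le] at h2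
  rw [add_sub_right_comm]
  nlinarith [norm_nonneg z]

/-- The kernel is centred at `s • e`, where `e` points to the side of the graph occupied by `Ω`,
with a radius small compared to the Lipschitz constant of the graph. Each segment then climbs faster
than the graph can rise beneath it. -/
theorem exists_isAveragingPiece_of_mem_frontier (hΩ : IsOpen Ω) (hb : Bornology.IsBounded Ω)
    (hC : HasC1Boundary Ω) {x₀ : EuclideanSpace ℝ (Fin N)} (hx₀ : x₀ ∈ frontier Ω) :
    ∃ (δ : ℝ) (η : EuclideanSpace ℝ (Fin N) → ℝ) (R : ℝ), 0 < δ ∧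
      IsAveragingPiece volume η R Ω (Ω ∩ Metric.ball x₀ δ) := by
  obtain ⟨e, γ, r₁, he, hγ, hinv, hr₁, hgraph⟩ := hC x₀ hx₀
  obtain ⟨K, V, hV, hK⟩ := (hγ.contDiffAt (x := x₀)).exists_lipschitzOnWith
  obtain ⟨r₂, hr₂, hr₂V⟩ := Metric.mem_nhds_iff.1 hV
  set r := min r₁ r₂ with hr
  have hr0 : 0 < r := lt_min hr₁ hr₂
  set s := r / 4 with hs
  have hs0 : 0 < s := by positivity
  have hK0 : (0 : ℝ) ≤ K := K.2
  -- A displacement `t • z` with `‖z - s • e‖ < ρ` gains height at least `t (s - ρ)` while the graph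
  -- rises by at most `K t ρ`; hence the need for `(1 + K) ρ ≤ s`. Since also `ρ ≤ s / 2` and `s = r
  -- / 4`, the segment stays in the ball of radius `r`, where the graph description holds.
  set ρ := s / (2 + K) with hρ
  have hρ0 : 0 < ρ := by positivity
  have hρK : ρ * (2 + K) = s := div_mul_cancel₀ _ (by positivity)
  obtain ⟨η, hη, hηs⟩ := exists_isAveragingKernel volume (s • e) hρ0
  refine ⟨s, η, _, hs0, hη, ?_, hΩ.measurableSet,
    hΩ.measurableSet.inter measurableSet_ball, hb, hb.subset Set.inter_subset_left⟩
  rintro x ⟨hxΩ, hx⟩ z hz t ⟨ht0, ht1⟩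
  set w := z - s • e with hw
  have hwρ : ‖w‖ < ρ := hηs z hz
  have hz' : x + t • z = (x + t • w) + (t * s) • e := by
    rw [hw, smul_sub, smul_smul]; abel
  rw [mem_ball_iff_norm] at hx
  have htw : ‖t • w‖ ≤ t * ρ := by
    rw [norm_smul, Real.norm_of_nonneg ht0.le]
    gcongr
  have hρs : ρ ≤ s / 2 := by nlinarith
  have htρ : t * ρ ≤ ρ := mul_le_of_le_one_left hρ0.le ht1
  have hts : t * s ≤ s := mul_le_of_le_one_left hs0.le ht1
  have hxw : ‖x + t • w - x₀‖ < s + ρ := by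
    have h2 := norm_add_le (x - x₀) (t • w)
    rw [add_sub_right_comm]
    linarith
  have hxz : ‖x + t • z - x₀‖ < r := by
    have h2 := norm_add_le (x + t • w - x₀) ((t * s) • e)
    rw [norm_smul, he, Real.norm_of_nonneg (by positivity)] at h2
    rw [hz', add_sub_right_comm]
    linarith
  have hxγ : γ x < inner ℝ e x := by
    have : x ∈ Ω ∩ Metric.ball x₀ r₁ := ⟨hxΩ, by
      rw [mem_ball_iff_norm]; linarith [min_le_left r₁ r₂]⟩
    rw [hgraph] at this
    exact this.1
  have hlip : γ (x + t • w) ≤ γ x + K * (t * ρ) := by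
    have h1 := hK.dist_le_mul (x + t • w)
      (hr₂V (by rw [mem_ball_iff_norm]; linarith [min_le_right r₁ r₂])) x
      (hr₂V (by rw [mem_ball_iff_norm]; linarith [min_le_right r₁ r₂]))
    rw [dist_eq_norm, dist_eq_norm, add_sub_cancel_left, Real.norm_eq_abs] at h1
    have h2 : (K : ℝ) * ‖t • w‖ ≤ K * (t * ρ) := by gcongr
    linarith [le_abs_self (γ (x + t • w) - γ x)]
  have hinner : inner ℝ e (x + t • z) ≥ inner ℝ e x - t * ρ + t * s := by
    rw [hz', inner_add_right, inner_add_right, inner_smul_right _ _ (t * s),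
      real_inner_self_eq_norm_sq, he]
    have h1 := abs_real_inner_le_norm e (t • w)
    rw [he, one_mul] at h1
    linarith [neg_abs_le (inner ℝ e (t • w))]
  have hmem : x + t • z ∈ {x | γ x < inner ℝ e x} ∩ Metric.ball x₀ r₁ := by
    refine ⟨?_, by rw [mem_ball_iff_norm]; linarith [min_le_left r₁ r₂]⟩
    show γ (x + t • z) < inner ℝ e (x + t • z)
    have hγz : γ (x + t • z) = γ (x + t • w) := by rw [hz', hinv]
    rw [hγz]
    have : K * (t * ρ) + t * ρ ≤ t * s := by
      have : t * (ρ * (2 + K)) = t * s := by rw [hρK]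
      nlinarith [mul_pos ht0 hρ0]
    linarith
  rw [← hgraph] at hmem
  exact hmem.1

/-- A bounded open set with `C¹` boundary is covered by finitely many averaging pieces. -/
theorem exists_finset_isAveragingPiece (hΩ : IsOpen Ω) (hb : Bornology.IsBounded Ω)
    (hC : HasC1Boundary Ω) :
    ∃ (t : Finset (EuclideanSpace ℝ (Fin N)))
      (η : EuclideanSpace ℝ (Fin N) → EuclideanSpace ℝ (Fin N) → ℝ)
      (R : EuclideanSpace ℝ (Fin N) → ℝ)
      (S : EuclideanSpace ℝ (Fin N) → Set (EuclideanSpace ℝ (Fin N))),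
      (∀ i ∈ t, IsAveragingPiece volume (η i) (R i) Ω (S i)) ∧ Ω ⊆ ⋃ i ∈ t, S i := by
  have key : ∀ x₀ ∈ closure Ω, ∃ (δ : ℝ) (η : EuclideanSpace ℝ (Fin N) → ℝ) (R : ℝ), 0 < δ ∧
      IsAveragingPiece volume η R Ω (Ω ∩ Metric.ball x₀ δ) := fun x₀ hx₀ => by
    by_cases h : x₀ ∈ Ω
    · exact exists_isAveragingPiece_of_mem hΩ hb h
    · exact exists_isAveragingPiece_of_mem_frontier hΩ hb hC
        (by rw [hΩ.frontier_eq]; exact ⟨hx₀, h⟩)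
  choose! δ η R hδ hP using key
  obtain ⟨t, ht, hcov⟩ := (hb.isCompact_closure).elim_nhds_subcover
    (fun x => Metric.ball x (δ x)) (fun x hx => Metric.ball_mem_nhds x (hδ x hx))
  refine ⟨t, η, R, fun x => Ω ∩ Metric.ball x (δ x), fun i hi => hP i (ht i hi), fun x hx => ?_⟩
  obtain ⟨i, hi, hxi⟩ := Set.mem_iUnion₂.1 (hcov (subset_closure hx))
  exact Set.mem_iUnion₂.2 ⟨i, hi, hx, hxi⟩

end

/-! ### Weighted measures and norms. -/

section

section WeightedMeasure

variable {α F : Type*} [MeasurableSpace α] [NormedAddCommGroup F] {μ : Measure α}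

theorem eLpNorm_restrict_union_le (f : α → F) {q : ℝ} (hq : 1 ≤ q) (S T : Set α) :
    eLpNorm f (ENNReal.ofReal q) (μ.restrict (S ∪ T)) ≤
      eLpNorm f (ENNReal.ofReal q) (μ.restrict S) +
        eLpNorm f (ENNReal.ofReal q) (μ.restrict T) := by
  have hq0 : 0 < q := by linarith
  simp only [eLpNorm_ofReal_eq _ hq0]
  refine le_trans ?_ (ENNReal.rpow_add_le_add_rpow _ _ (by positivity)
    (by rw [div_le_one hq0]; exact hq))
  gcongr
  exact lintegral_union_le _ _ _

theorem eLpNorm_restrict_biUnion_finset_le {ι : Type*} (f : α → F) {q : ℝ} (hq : 1 ≤ q)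
    (t : Finset ι) (S : ι → Set α) :
    eLpNorm f (ENNReal.ofReal q) (μ.restrict (⋃ i ∈ t, S i)) ≤
      ∑ i ∈ t, eLpNorm f (ENNReal.ofReal q) (μ.restrict (S i)) := by
  classical
  induction t using Finset.induction_on with
  | empty => simp
  | insert a t ha ih =>
    rw [Finset.set_biUnion_insert, Finset.sum_insert ha]
    exact (eLpNorm_restrict_union_le f hq _ _).trans (by gcongr)

/-- Hölder's inequality for a norm with an integrable weight. -/
theorem eLpNorm_withDensity_le {b : α → ℝ≥0∞} (hb : AEMeasurable b μ) (hbt : ∀ᵐ x ∂μ, b x < ⊤)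
    {f : α → F} (hf : AEStronglyMeasurable f μ) {q s : ℝ} (hq : 0 < q) (hqs : q < s) :
    eLpNorm f (ENNReal.ofReal q) (μ.withDensity b) ≤
      ((∫⁻ x, b x ^ (s / (s - q)) ∂μ) ^ ((s - q) / s)) ^ (1 / q) *
        eLpNorm f (ENNReal.ofReal s) μ := by
  have hs : 0 < s := hq.trans hqs
  have hc : (s / (s - q)).HolderConjugate (s / q) := by
    rw [Real.holderConjugate_iff]
    refine ⟨by rw [one_lt_div (by linarith)]; linarith, ?_⟩
    have : s - q ≠ 0 := by linarith
    field_simp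
    ring
  rw [eLpNorm_ofReal_eq _ hq, eLpNorm_ofReal_eq _ hs,
    lintegral_withDensity_eq_lintegral_mul_non_measurable₀ _ hb hbt]
  have h := ENNReal.lintegral_mul_le_Lp_mul_Lq μ hc hb (hf.enorm.pow_const q)
  have h1 : ∀ x, (‖f x‖ₑ ^ q) ^ (s / q) = ‖f x‖ₑ ^ s := fun x => by
    rw [← ENNReal.rpow_mul, mul_div_cancel₀ _ hq.ne']
  simp only [h1] at h
  refine (ENNReal.rpow_le_rpow h (by positivity : 0 ≤ 1 / q)).trans (le_of_eq ?_)
  rw [ENNReal.mul_rpow_of_nonneg _ _ (by positivity), one_div_div, one_div_div,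
    ← ENNReal.rpow_mul _ (q / s), show q / s * (1 / q) = 1 / s by field_simp]

end WeightedMeasure

variable {N : ℕ}

/-- The measure `A dx` on `Ω`. -/
noncomputable def weightedMeasure (A : EuclideanSpace ℝ (Fin N) → ℝ)
    (Ω : Set (EuclideanSpace ℝ (Fin N))) : Measure (EuclideanSpace ℝ (Fin N)) :=
  (volume.restrict Ω).withDensity fun x => ENNReal.ofReal (A x)

variable {A : EuclideanSpace ℝ (Fin N) → ℝ} {Ω : Set (EuclideanSpace ℝ (Fin N))} {p q : ℝ}

theorem lintegral_weightedMeasure (hA : AEMeasurable A) (f : EuclideanSpace ℝ (Fin N) → ℝ≥0∞) :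
    ∫⁻ x, f x ∂(weightedMeasure A Ω) = ∫⁻ x in Ω, f x * ENNReal.ofReal (A x) := by
  rw [weightedMeasure, lintegral_withDensity_eq_lintegral_mul_non_measurable₀ _
    hA.restrict.ennreal_ofReal (.of_forall fun _ => ENNReal.ofReal_lt_top)]
  simp only [Pi.mul_apply, mul_comm]

theorem LqBNorm_eq_eLpNorm (hA : AEMeasurable A) (hq : 0 < q)
    (u : EuclideanSpace ℝ (Fin N) → ℝ) :
    LqBNorm q A Ω u = eLpNorm u (ENNReal.ofReal q) (weightedMeasure A Ω) := by
  rw [eLpNorm_ofReal_eq _ hq, lintegral_weightedMeasure hA, LqBNorm]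

theorem weightedMeasure_absolutelyContinuous :
    weightedMeasure A Ω ≪ volume.restrict Ω :=
  withDensity_absolutelyContinuous _ _

theorem absolutelyContinuous_weightedMeasure (hA : AEMeasurable A) (hpos : ∀ᵐ x, 0 < A x) :
    volume.restrict Ω ≪ weightedMeasure A Ω :=
  withDensity_absolutelyContinuous' hA.restrict.ennreal_ofReal
    ((ae_restrict_of_ae hpos).mono fun x hx => by simpa using hx)

theorem weightedMeasure_le (Ω : Set (EuclideanSpace ℝ (Fin N))) :
    weightedMeasure A Ω ≤ eLpNorm A ⊤ volume • volume.restrict Ω := by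
  rw [weightedMeasure, ← withDensity_const]
  refine withDensity_mono ?_
  filter_upwards [ae_restrict_of_ae (ae_le_eLpNormEssSup (f := A) (μ := volume))] with x hx
  rw [eLpNorm_exponent_top]
  exact (Real.ofReal_le_enorm _).trans hx

theorem eLpNorm_weightedMeasure_le {F : Type*} [NormedAddCommGroup F]
    (f : EuclideanSpace ℝ (Fin N) → F) (hq : 0 < q) :
    eLpNorm f (ENNReal.ofReal q) (weightedMeasure A Ω) ≤
      eLpNorm A ⊤ volume ^ (1 / q) * eLpNorm f (ENNReal.ofReal q) (volume.restrict Ω) := by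
  refine (eLpNorm_mono_measure f (weightedMeasure_le Ω)).trans (le_of_eq ?_)
  rw [eLpNorm_smul_measure_of_ne_top ENNReal.ofReal_ne_top, smul_eq_mul,
    ENNReal.toReal_div, ENNReal.toReal_ofReal hq.le, ENNReal.toReal_one]

/-- A norm equivalent to `pairNorm`. -/
noncomputable def sumNorm (p : ℝ) (A : EuclideanSpace ℝ (Fin N) → ℝ)
    (Ω : Set (EuclideanSpace ℝ (Fin N))) (u : EuclideanSpace ℝ (Fin N) → ℝ)
    (v : EuclideanSpace ℝ (Fin N) → EuclideanSpace ℝ (Fin N)) : ℝ≥0∞ :=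
  eLpNorm v (ENNReal.ofReal p) (volume.restrict Ω) +
    eLpNorm u (ENNReal.ofReal p) (weightedMeasure A Ω)

theorem sumNorm_le_two_mul_pairNorm (hA : AEMeasurable A) (hp : 0 < p)
    (u : EuclideanSpace ℝ (Fin N) → ℝ)
    (v : EuclideanSpace ℝ (Fin N) → EuclideanSpace ℝ (Fin N)) :
    sumNorm p A Ω u v ≤ 2 * pairNorm p A Ω u v := by
  rw [sumNorm, pairNorm, two_mul, eLpNorm_ofReal_eq _ hp, eLpNorm_ofReal_eq _ hp,
    lintegral_weightedMeasure hA]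
  gcongr with x x
  · exact le_self_add
  · rw [mul_comm]; exact le_add_self

theorem pairNorm_mono_set {Ω' : Set (EuclideanSpace ℝ (Fin N))} (h : Ω ⊆ Ω') (hp : 0 < p)
    (u : EuclideanSpace ℝ (Fin N) → ℝ)
    (v : EuclideanSpace ℝ (Fin N) → EuclideanSpace ℝ (Fin N)) :
    pairNorm p A Ω u v ≤ pairNorm p A Ω' u v := by
  rw [pairNorm, pairNorm]
  gcongr

theorem sumNorm_add_le (hp : 1 ≤ p) {u u' : EuclideanSpace ℝ (Fin N) → ℝ}
    {v v' : EuclideanSpace ℝ (Fin N) → EuclideanSpace ℝ (Fin N)}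
    (hu : AEStronglyMeasurable u (volume.restrict Ω))
    (hu' : AEStronglyMeasurable u' (volume.restrict Ω))
    (hv : AEStronglyMeasurable v (volume.restrict Ω))
    (hv' : AEStronglyMeasurable v' (volume.restrict Ω)) :
    sumNorm p A Ω (u + u') (v + v') ≤ sumNorm p A Ω u v + sumNorm p A Ω u' v' := by
  have hp1 : 1 ≤ ENNReal.ofReal p := by
    rw [← ENNReal.ofReal_one]; exact ENNReal.ofReal_le_ofReal hp
  rw [sumNorm, sumNorm, sumNorm, add_add_add_comm]
  exact add_le_add (eLpNorm_add_le hv hv' hp1)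
    (eLpNorm_add_le (hu.mono_ac weightedMeasure_absolutelyContinuous)
      (hu'.mono_ac weightedMeasure_absolutelyContinuous) hp1)

theorem sumNorm_sub_comm (u u' : EuclideanSpace ℝ (Fin N) → ℝ)
    (v v' : EuclideanSpace ℝ (Fin N) → EuclideanSpace ℝ (Fin N)) :
    sumNorm p A Ω (u - u') (v - v') = sumNorm p A Ω (u' - u) (v' - v) := by
  rw [sumNorm, sumNorm, eLpNorm_sub_comm, eLpNorm_sub_comm u]

theorem norm_gradient (φ : EuclideanSpace ℝ (Fin N) → ℝ) (x : EuclideanSpace ℝ (Fin N)) :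
    ‖gradient φ x‖ = ‖fderiv ℝ φ x‖ :=
  LinearIsometryEquiv.norm_map _ _

theorem eLpNorm_gradient (φ : EuclideanSpace ℝ (Fin N) → ℝ) (r : ℝ≥0∞)
    (μ : Measure (EuclideanSpace ℝ (Fin N))) :
    eLpNorm (gradient φ) r μ = eLpNorm (fderiv ℝ φ) r μ :=
  eLpNorm_congr_norm_ae (.of_forall fun x => norm_gradient φ x)

namespace IsTest

variable {φ ψ : EuclideanSpace ℝ (Fin N) → ℝ}

theorem contDiff_one (hφ : IsTest Set.univ φ) : ContDiff ℝ 1 φ :=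
  hφ.1.of_le (by exact_mod_cast le_top)

theorem continuous_gradient (hφ : IsTest Set.univ φ) : Continuous (gradient φ) :=
  (LinearIsometryEquiv.continuous _).comp (hφ.contDiff_one.continuous_fderiv one_ne_zero)

theorem hasCompactSupport_gradient (hφ : IsTest Set.univ φ) : HasCompactSupport (gradient φ) :=
  (hφ.2.1.fderiv ℝ).comp_left (map_zero _)

theorem sub (hφ : IsTest Set.univ φ) (hψ : IsTest Set.univ ψ) : IsTest Set.univ (φ - ψ) :=
  ⟨hφ.1.sub hψ.1, hφ.2.1.sub hψ.2.1, Set.subset_univ _⟩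

theorem gradient_sub (hφ : IsTest Set.univ φ) (hψ : IsTest Set.univ ψ) :
    gradient (φ - ψ) = gradient φ - gradient ψ := by
  ext1 x
  rw [gradient, fderiv_sub (hφ.contDiff_one.differentiable one_ne_zero x)
    (hψ.contDiff_one.differentiable one_ne_zero x), map_sub]
  rfl

theorem aestronglyMeasurable (hφ : IsTest Set.univ φ)
    (μ : Measure (EuclideanSpace ℝ (Fin N))) : AEStronglyMeasurable φ μ :=
  hφ.1.continuous.aestronglyMeasurable

theorem aestronglyMeasurable_gradient (hφ : IsTest Set.univ φ)
    (μ : Measure (EuclideanSpace ℝ (Fin N))) : AEStronglyMeasurable (gradient φ) μ :=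
  hφ.continuous_gradient.aestronglyMeasurable

theorem sumNorm_lt_top (hφ : IsTest Set.univ φ) (hA : MemLp A ⊤ volume) (hp : 0 < p) :
    sumNorm p A Ω φ (gradient φ) < ⊤ := by
  refine ENNReal.add_lt_top.2 ⟨?_, (eLpNorm_weightedMeasure_le φ hp).trans_lt ?_⟩
  · exact (hφ.continuous_gradient.memLp_of_hasCompactSupport hφ.hasCompactSupport_gradient).2
  · refine ENNReal.mul_lt_top (ENNReal.rpow_lt_top_of_nonneg (by positivity) hA.2.ne) ?_
    exact (hφ.1.continuous.memLp_of_hasCompactSupport hφ.2.1).2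

end IsTest

/-- On bounded sets the weighted norm controls the `L¹` norm. -/
theorem exists_eLpNorm_one_le (hA : AEMeasurable A) (hpos : ∀ᵐ x, 0 < A x) (hp : 1 < p)
    (hA_inv : LocallyIntegrable (fun x => A x ^ (-(1 / (p - 1)))) volume)
    {U : Set (EuclideanSpace ℝ (Fin N))} (hU : Bornology.IsBounded U) (hUΩ : U ⊆ Ω) :
    ∃ D : ℝ≥0∞, D ≠ ⊤ ∧ ∀ φ : EuclideanSpace ℝ (Fin N) → ℝ, Continuous φ →
      eLpNorm φ 1 (volume.restrict U) ≤
        D * eLpNorm φ (ENNReal.ofReal p) (weightedMeasure A Ω) := by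
  have hp0 : 0 < p := by linarith
  have hp1 : 0 < p - 1 := by linarith
  -- Hölder is applied to `|φ| = (A^{1/p} |φ|) · A^{-1/p}`; the conjugate exponent `p / (p - 1)`
  -- turns the last factor into `A^{-1/(p-1)}`.
  set J := ∫⁻ x in U, ENNReal.ofReal (A x) ^ (-(1 / (p - 1))) with hJ
  have hJt : J ≠ ⊤ := by
    have h1 := (hA_inv.integrableOn_isCompact hU.isCompact_closure).mono_set subset_closure
    have h2 := h1.2
    refine ne_top_of_le_ne_top h2.ne (lintegral_mono_ae ?_)
    filter_upwards [ae_restrict_of_ae hpos] with x hx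
    rw [ENNReal.ofReal_rpow_of_pos hx]
    exact Real.ofReal_le_enorm _
  have hc : p.HolderConjugate (p / (p - 1)) := Real.HolderConjugate.conjExponent hp
  refine ⟨J ^ (1 / (p / (p - 1))), ENNReal.rpow_ne_top_of_nonneg (by positivity) hJt,
    fun φ hφ => ?_⟩
  have hAm : AEMeasurable (fun x => ENNReal.ofReal (A x)) (volume.restrict U) :=
    hA.restrict.ennreal_ofReal
  have h := ENNReal.lintegral_mul_le_Lp_mul_Lq (volume.restrict U) hc
    (f := fun x => ENNReal.ofReal (A x) ^ (1 / p) * ‖φ x‖ₑ)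
    (g := fun x => ENNReal.ofReal (A x) ^ (-(1 / p)))
    ((hAm.pow_const _).mul hφ.measurable.enorm.aemeasurable) (hAm.pow_const _)
  rw [eLpNorm_one_eq_lintegral_enorm, eLpNorm_ofReal_eq _ hp0, lintegral_weightedMeasure hA]
  calc ∫⁻ x in U, ‖φ x‖ₑ
      = ∫⁻ x in U, ((fun x => ENNReal.ofReal (A x) ^ (1 / p) * ‖φ x‖ₑ) *
          fun x => ENNReal.ofReal (A x) ^ (-(1 / p))) x := by
        refine lintegral_congr_ae ?_
        filter_upwards [ae_restrict_of_ae hpos] with x hx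
        simp only [Pi.mul_apply]
        rw [mul_right_comm, ← ENNReal.rpow_add _ _ (by simpa using hx) ENNReal.ofReal_ne_top]
        simp
    _ ≤ _ := h
    _ ≤ _ := by
        rw [mul_comm]
        gcongr ?_ ^ _ * ?_ ^ _
        · refine le_of_eq (lintegral_congr fun x => ?_)
          rw [← ENNReal.rpow_mul]
          congr 1
          field_simp
        · refine (lintegral_mono_set hUΩ).trans (le_of_eq (lintegral_congr fun x => ?_))
          rw [ENNReal.mul_rpow_of_nonneg _ _ hp0.le, ← ENNReal.rpow_mul,
            one_div_mul_cancel hp0.ne', ENNReal.rpow_one, mul_comm]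

end

/-! ### Embedding and compactness for test functions. -/

section

variable {N : ℕ} {A B : EuclideanSpace ℝ (Fin N) → ℝ} {Ω : Set (EuclideanSpace ℝ (Fin N))}
  {p q : ℝ}

theorem pStar_pos (hp : 1 < p) (hpN : p < N) : 0 < pStar N p := by
  have h1 : (0 : ℝ) < N - p := by linarith
  have h2 : (0 : ℝ) < N := by linarith
  unfold pStar
  positivity

/-- Cleared of denominators, both inequalities read `N (q - p) < q p`. This is the form of
subcriticality used by the averaging estimates. -/
theorem mul_sub_one_lt_of_lt_pStar (hp : 1 < p) (hpN : p < N) (hq : q < pStar N p) :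
    (Module.finrank ℝ (EuclideanSpace ℝ (Fin N)) : ℝ) * (q / p - 1) < q := by
  have h1 : (0 : ℝ) < N - p := by linarith
  rw [pStar, lt_div_iff₀ h1] at hq
  rw [finrank_euclideanSpace_fin, div_sub_one (by linarith), ← mul_div_assoc,
    div_lt_iff₀ (by linarith)]
  nlinarith

section Bounded

/-- On a bounded open set with `C¹` boundary, a weight is controlled on finitely many averaging
pieces. -/
theorem eLpNorm_weightedMeasure_le_sum {t : Finset (EuclideanSpace ℝ (Fin N))}
    {S : EuclideanSpace ℝ (Fin N) → Set (EuclideanSpace ℝ (Fin N))} (hcov : Ω ⊆ ⋃ i ∈ t, S i)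
    (hq : 1 ≤ q) (φ : EuclideanSpace ℝ (Fin N) → ℝ) :
    eLpNorm φ (ENNReal.ofReal q) (weightedMeasure B Ω) ≤ eLpNorm B ⊤ volume ^ (1 / q) *
      ∑ i ∈ t, eLpNorm φ (ENNReal.ofReal q) (volume.restrict (S i)) := by
  refine (eLpNorm_weightedMeasure_le φ (by linarith)).trans ?_
  gcongr
  exact (eLpNorm_mono_measure φ (Measure.restrict_mono hcov le_rfl)).trans
    (eLpNorm_restrict_biUnion_finset_le φ hq t S)

theorem exists_eLpNorm_le_sumNorm_of_isBounded (hp : 1 < p) (hpq : p < q)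
    (hq : (Module.finrank ℝ (EuclideanSpace ℝ (Fin N)) : ℝ) * (q / p - 1) < q)
    (hA : AEMeasurable A) (hA_pos : ∀ᵐ x, 0 < A x)
    (hA_inv : LocallyIntegrable (fun x => A x ^ (-(1 / (p - 1)))) volume)
    (hB : MemLp B ⊤ volume) (hΩ : IsOpen Ω) (hb : Bornology.IsBounded Ω)
    (hC1 : HasC1Boundary Ω) :
    ∃ C : ℝ≥0∞, C ≠ ⊤ ∧ ∀ φ, IsTest Set.univ φ →
      eLpNorm φ (ENNReal.ofReal q) (weightedMeasure B Ω) ≤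
        C * sumNorm p A Ω φ (gradient φ) := by
  obtain ⟨t, η, R, S, hP, hcov⟩ := exists_finset_isAveragingPiece hΩ hb hC1
  have key : ∀ i ∈ t, ∃ C : ℝ≥0∞, C ≠ ⊤ ∧ ∀ φ : EuclideanSpace ℝ (Fin N) → ℝ, ContDiff ℝ 1 φ →
      eLpNorm φ (ENNReal.ofReal q) (volume.restrict (S i)) ≤
        C * (eLpNorm (fderiv ℝ φ) (ENNReal.ofReal p) (volume.restrict Ω) +
          eLpNorm φ 1 (volume.restrict Ω)) :=
    fun i hi => (hP i hi).exists_eLpNorm_le hp.le hpq.le hq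
  choose! C hC hCb using key
  obtain ⟨D, hD, hDb⟩ := exists_eLpNorm_one_le hA hA_pos hp hA_inv hb subset_rfl
  refine ⟨eLpNorm B ⊤ volume ^ (1 / q) * ∑ i ∈ t, C i * (1 + D), ?_, fun φ hφ => ?_⟩
  · refine ENNReal.mul_ne_top (ENNReal.rpow_ne_top_of_nonneg
      (one_div_nonneg.2 (by linarith)) hB.2.ne) (ENNReal.sum_ne_top.2 fun i hi => ?_)
    exact ENNReal.mul_ne_top (hC i hi) (by finiteness)
  · refine (eLpNorm_weightedMeasure_le_sum hcov (by linarith) φ).trans ?_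
    rw [mul_assoc, Finset.sum_mul]
    gcongr with i hi
    refine (hCb i hi φ hφ.contDiff_one).trans ?_
    rw [mul_assoc, sumNorm, eLpNorm_gradient]
    gcongr C i * ?_
    refine (add_le_add le_rfl (hDb φ hφ.1.continuous)).trans ?_
    rw [add_mul, one_mul, mul_add, add_assoc]
    gcongr
    exact le_add_self.trans le_add_self

theorem exists_subseq_of_isBounded (hp : 1 < p) (hpq : p < q)
    (hq : (Module.finrank ℝ (EuclideanSpace ℝ (Fin N)) : ℝ) * (q / p - 1) < q)
    (hA : AEMeasurable A) (hA_pos : ∀ᵐ x, 0 < A x)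
    (hA_inv : LocallyIntegrable (fun x => A x ^ (-(1 / (p - 1)))) volume)
    (hB : MemLp B ⊤ volume) (hΩ : IsOpen Ω) (hb : Bornology.IsBounded Ω)
    (hC1 : HasC1Boundary Ω) {φ : ℕ → EuclideanSpace ℝ (Fin N) → ℝ}
    (hφ : ∀ n, IsTest Set.univ (φ n)) {M : ℝ≥0}
    (hM : ∀ n, sumNorm p A Ω (φ n) (gradient (φ n)) ≤ M) :
    ∃ σ : ℕ → ℕ, StrictMono σ ∧ Tendsto (fun n : ℕ × ℕ =>
      eLpNorm (φ (σ n.1) - φ (σ n.2)) (ENNReal.ofReal q) (weightedMeasure B Ω)) atTop (𝓝 0) := by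
  obtain ⟨t, η, R, S, hP, hcov⟩ := exists_finset_isAveragingPiece hΩ hb hC1
  obtain ⟨D, hD, hDb⟩ := exists_eLpNorm_one_le hA hA_pos hp hA_inv hb subset_rfl
  obtain ⟨σ, hσ, hc⟩ := exists_subseq_tendsto_eLpNorm_sub (μ := volume)
    (ι := t) (η := fun i => η i) (R := fun i => R i) (U := fun _ => Ω) (S := fun i => S i)
    (fun i => hP i i.2) hp.le hpq.le hq (fun n => (hφ n).contDiff_one)
    (fun _ => ⟨M, fun n => by
      rw [← eLpNorm_gradient]; exact le_self_add.trans (hM n)⟩)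
    (fun _ => ⟨D.toNNReal * M, fun n => by
      rw [ENNReal.coe_mul, ENNReal.coe_toNNReal hD]
      refine (hDb _ (hφ n).1.continuous).trans ?_
      gcongr
      exact le_add_self.trans (hM n)⟩)
  refine ⟨σ, hσ, ?_⟩
  have hB' : eLpNorm B ⊤ volume ^ (1 / q) ≠ ⊤ :=
    ENNReal.rpow_ne_top_of_nonneg (one_div_nonneg.2 (by linarith)) hB.2.ne
  have hsum : Tendsto (fun n : ℕ × ℕ => eLpNorm B ⊤ volume ^ (1 / q) * ∑ i ∈ t,
      eLpNorm (φ (σ n.1) - φ (σ n.2)) (ENNReal.ofReal q) (volume.restrict (S i)))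
      atTop (𝓝 0) := by
    have h1 : Tendsto (fun n : ℕ × ℕ => ∑ i ∈ t,
        eLpNorm (φ (σ n.1) - φ (σ n.2)) (ENNReal.ofReal q) (volume.restrict (S i)))
        atTop (𝓝 (∑ i ∈ t, 0)) := tendsto_finsetSum t fun i hi => hc ⟨i, hi⟩
    simpa using ENNReal.Tendsto.const_mul h1 (.inr hB')
  exact tendsto_of_tendsto_of_tendsto_of_le_of_le tendsto_const_nhds hsum
    (fun _ => zero_le) (fun n => eLpNorm_weightedMeasure_le_sum hcov (by linarith) _)

end Bounded

/-! ### The whole space: Sobolev inequality and tails. -/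

section WholeSpace

theorem exists_eLpNorm_pStar_le (hp : 1 < p) (hpN : p < N) :
    ∃ C : ℝ≥0∞, C ≠ ⊤ ∧ ∀ φ : EuclideanSpace ℝ (Fin N) → ℝ, IsTest Set.univ φ →
      eLpNorm φ (ENNReal.ofReal (pStar N p)) volume ≤
        C * eLpNorm (gradient φ) (ENNReal.ofReal p) volume := by
  refine ⟨SNormLESNormFDerivOfEqConst ℝ (volume : Measure (EuclideanSpace ℝ (Fin N)))
    p.toNNReal, ENNReal.coe_ne_top, fun φ hφ => ?_⟩
  rw [eLpNorm_gradient]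
  have hN : (0 : ℝ) < N := by linarith
  refine eLpNorm_le_eLpNorm_fderiv_of_eq volume hφ.contDiff_one hφ.2.1 (p := p.toNNReal)
    (p' := (pStar N p).toNNReal) ?_ ?_ ?_
  · rw [← Real.toNNReal_one]; exact Real.toNNReal_le_toNNReal hp.le
  · rw [finrank_euclideanSpace_fin]; exact_mod_cast hN
  · rw [finrank_euclideanSpace_fin, NNReal.coe_inv,
      Real.coe_toNNReal _ (pStar_pos hp hpN).le, Real.coe_toNNReal p (by linarith), pStar]
    have h1 : (N : ℝ) - p ≠ 0 := by linarith
    have h2 : p ≠ 0 := by linarith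
    field_simp

/-- The factor by which Hölder's inequality controls `L^q_B(T)` by `L^s(T)`. -/
noncomputable def holderFactor (B : EuclideanSpace ℝ (Fin N) → ℝ) (q s : ℝ)
    (T : Set (EuclideanSpace ℝ (Fin N))) : ℝ≥0∞ :=
  ((∫⁻ x in T, ENNReal.ofReal (B x) ^ (s / (s - q))) ^ ((s - q) / s)) ^ (1 / q)

theorem lintegral_ofReal_rpow_lt_top {r : ℝ} (hr : 0 < r) (hB : MemLp B (ENNReal.ofReal r) volume)
    (T : Set (EuclideanSpace ℝ (Fin N))) : ∫⁻ x in T, ENNReal.ofReal (B x) ^ r < ⊤ := by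
  have h := lintegral_rpow_enorm_lt_top_of_eLpNorm_lt_top (by simpa using hr)
    ENNReal.ofReal_ne_top hB.2
  rw [ENNReal.toReal_ofReal hr.le] at h
  refine (setLIntegral_le_lintegral T _).trans_lt (lt_of_le_of_lt (lintegral_mono fun x => ?_) h)
  gcongr
  exact Real.ofReal_le_enorm _

/-- Hölder with exponent `p*` followed by the Sobolev inequality. The constant does not depend on
`T`: taking everything gives the embedding, and complements of balls give the tails. -/
theorem exists_eLpNorm_weightedMeasure_le_holderFactor (hp : 1 < p) (hpN : p < N) (hpq : p < q)
    (hq : q < pStar N p) (hB : AEMeasurable B) :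
    ∃ C : ℝ≥0∞, C ≠ ⊤ ∧ ∀ φ : EuclideanSpace ℝ (Fin N) → ℝ, IsTest Set.univ φ →
      ∀ T : Set (EuclideanSpace ℝ (Fin N)),
        eLpNorm φ (ENNReal.ofReal q) (weightedMeasure B T) ≤
          holderFactor B q (pStar N p) T * (C * sumNorm p A Set.univ φ (gradient φ)) := by
  obtain ⟨C, hC, hCb⟩ := exists_eLpNorm_pStar_le hp hpN
  refine ⟨C, hC, fun φ hφ T => ?_⟩
  refine (eLpNorm_withDensity_le hB.restrict.ennreal_ofReal
    (.of_forall fun _ => ENNReal.ofReal_lt_top) (hφ.aestronglyMeasurable _) (by linarith)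
    hq).trans ?_
  refine mul_le_mul' le_rfl ((eLpNorm_mono_measure φ Measure.restrict_le_self).trans
    ((hCb φ hφ).trans (mul_le_mul' le_rfl ?_)))
  rw [sumNorm, Measure.restrict_univ]
  exact le_self_add

theorem holderFactor_ne_top (hp : 1 < p) (hpq : p < q) (hq : q < pStar N p)
    (hB_int : MemLp B (ENNReal.ofReal (pStar N p / (pStar N p - q))) volume)
    (T : Set (EuclideanSpace ℝ (Fin N))) : holderFactor B q (pStar N p) T ≠ ⊤ := by
  have h1 : 0 < pStar N p - q := by linarith
  have h2 : 0 < pStar N p := by linarith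
  have h3 : 0 < q := by linarith
  exact ENNReal.rpow_ne_top_of_nonneg (by positivity) (ENNReal.rpow_ne_top_of_nonneg
    (by positivity) (lintegral_ofReal_rpow_lt_top (by positivity) hB_int T).ne)

/-- Continuity from above of the finite measure `B^{p*/(p*-q)} dx` along complements of growing
balls. -/
theorem tendsto_holderFactor_compl_ball (hp : 1 < p) (hpq : p < q) (hq : q < pStar N p)
    (hB_int : MemLp B (ENNReal.ofReal (pStar N p / (pStar N p - q))) volume) :
    Tendsto (fun k : ℕ => holderFactor B q (pStar N p) (Metric.ball 0 (k : ℝ))ᶜ)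
      atTop (𝓝 0) := by
  have h1 : 0 < pStar N p - q := by linarith
  have h2 : 0 < pStar N p := by linarith
  have h3 : 0 < q := by linarith
  set ν := (volume : Measure (EuclideanSpace ℝ (Fin N))).withDensity
    fun x => ENNReal.ofReal (B x) ^ (pStar N p / (pStar N p - q)) with hν
  have hm : ∀ k : ℕ, MeasurableSet (Metric.ball (0 : EuclideanSpace ℝ (Fin N)) (k : ℝ))ᶜ :=
    fun k => measurableSet_ball.compl
  have h := tendsto_measure_iInter_atTop (μ := ν)
    (s := fun k : ℕ => (Metric.ball (0 : EuclideanSpace ℝ (Fin N)) (k : ℝ))ᶜ)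
    (fun k => (hm k).nullMeasurableSet)
    (fun k l hkl => Set.compl_subset_compl.2 (Metric.ball_subset_ball (by exact_mod_cast hkl)))
    ⟨0, by
      rw [hν, withDensity_apply _ (hm 0)]
      exact (lintegral_ofReal_rpow_lt_top (by positivity) hB_int _).ne⟩
  have hempty : ⋂ k : ℕ, (Metric.ball (0 : EuclideanSpace ℝ (Fin N)) (k : ℝ))ᶜ = ∅ := by
    rw [← Set.compl_iUnion, Metric.iUnion_ball_nat, Set.compl_univ]
  rw [hempty, measure_empty] at h
  have h' := (h.ennrpow_const ((pStar N p - q) / pStar N p)).ennrpow_const (1 / q)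
  rw [ENNReal.zero_rpow_of_pos (by positivity), ENNReal.zero_rpow_of_pos (by positivity)] at h'
  refine h'.congr fun k => ?_
  simp only [Function.comp_apply, hν, withDensity_apply _ (hm k), holderFactor]

theorem exists_eLpNorm_le_sumNorm_univ (hp : 1 < p) (hpN : p < N) (hpq : p < q)
    (hq : q < pStar N p) (hB : AEMeasurable B)
    (hB_int : MemLp B (ENNReal.ofReal (pStar N p / (pStar N p - q))) volume) :
    ∃ C : ℝ≥0∞, C ≠ ⊤ ∧ ∀ φ, IsTest Set.univ φ →
      eLpNorm φ (ENNReal.ofReal q) (weightedMeasure B Set.univ) ≤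
        C * sumNorm p A Set.univ φ (gradient φ) := by
  obtain ⟨C, hC, hCb⟩ := exists_eLpNorm_weightedMeasure_le_holderFactor (A := A) hp hpN hpq hq hB
  refine ⟨_, ENNReal.mul_ne_top (holderFactor_ne_top hp hpq hq hB_int Set.univ) hC,
    fun φ hφ => ?_⟩
  rw [mul_assoc]
  exact hCb φ hφ _

theorem exists_subseq_univ (hp : 1 < p) (hpN : p < N) (hpq : p < q)
    (hq : q < pStar N p) (hA : AEMeasurable A) (hA_pos : ∀ᵐ x, 0 < A x)
    (hA_inv : LocallyIntegrable (fun x => A x ^ (-(1 / (p - 1)))) volume)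
    (hB : MemLp B ⊤ volume)
    (hB_int : MemLp B (ENNReal.ofReal (pStar N p / (pStar N p - q))) volume)
    {φ : ℕ → EuclideanSpace ℝ (Fin N) → ℝ} (hφ : ∀ n, IsTest Set.univ (φ n)) {M : ℝ≥0}
    (hM : ∀ n, sumNorm p A Set.univ (φ n) (gradient (φ n)) ≤ M) :
    ∃ σ : ℕ → ℕ, StrictMono σ ∧ Tendsto (fun n : ℕ × ℕ =>
      eLpNorm (φ (σ n.1) - φ (σ n.2)) (ENNReal.ofReal q) (weightedMeasure B Set.univ))
        atTop (𝓝 0) := by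
  have hκ := mul_sub_one_lt_of_lt_pStar hp hpN hq
  have hq1 : 1 ≤ q := by linarith
  obtain ⟨η, hη, -⟩ := exists_isAveragingKernel volume (0 : EuclideanSpace ℝ (Fin N)) one_pos
  obtain ⟨C, hC, hCb⟩ := exists_eLpNorm_weightedMeasure_le_holderFactor (A := A) hp hpN hpq hq
    hB.1.aemeasurable
  rw [norm_zero, zero_add] at hη
  -- The kernel has radius one, so averages at scales at most one on the ball of radius `k` only see
  -- the ball of radius `k + 1`.
  have hP : ∀ k : ℕ, IsAveragingPiece volume η 1
      (Metric.ball (0 : EuclideanSpace ℝ (Fin N)) (k + 1)) (Metric.ball 0 k) := fun k => by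
    refine ⟨hη, fun x hx z hz t ht => ?_, measurableSet_ball, measurableSet_ball,
      Metric.isBounded_ball, Metric.isBounded_ball⟩
    rw [mem_ball_zero_iff] at hx ⊢
    have h1 := norm_add_le x (t • z)
    rw [norm_smul, Real.norm_of_nonneg ht.1.le] at h1
    nlinarith [hη.norm_le z hz, norm_nonneg z, ht.1, ht.2]
  obtain ⟨σ, hσ, hc⟩ := exists_subseq_tendsto_eLpNorm_sub (μ := volume) hP
    hp.le hpq.le hκ (fun n => (hφ n).contDiff_one)
    (fun _ => ⟨M, fun n => by
      rw [← eLpNorm_gradient]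
      refine (eLpNorm_mono_measure _ Measure.restrict_le_self).trans (le_trans ?_ (hM n))
      rw [sumNorm, Measure.restrict_univ]
      exact le_self_add⟩)
    (fun k => by
      obtain ⟨D, hD, hDb⟩ := exists_eLpNorm_one_le hA hA_pos hp hA_inv
        (Metric.isBounded_ball (x := (0 : EuclideanSpace ℝ (Fin N))) (r := (k : ℝ) + 1))
        (Set.subset_univ _)
      refine ⟨D.toNNReal * M, fun n => ?_⟩
      rw [ENNReal.coe_mul, ENNReal.coe_toNNReal hD]
      refine (hDb _ (hφ n).1.continuous).trans ?_
      gcongr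
      exact le_add_self.trans (hM n))
  refine ⟨σ, hσ, ?_⟩
  have hB' : eLpNorm B ⊤ volume ^ (1 / q) ≠ ⊤ :=
    ENNReal.rpow_ne_top_of_nonneg (one_div_nonneg.2 (by linarith)) hB.2.ne
  have htail := ENNReal.Tendsto.mul_const
    (tendsto_holderFactor_compl_ball hp hpq hq hB_int) (b := C * (M + M))
    (.inr (by finiteness))
  rw [zero_mul] at htail
  rw [ENNReal.tendsto_nhds_zero]
  intro ε hε
  have hε2 : 0 < ε / 2 := ENNReal.half_pos hε.ne'
  -- The ball is chosen before the indices: differences of terms have norm at most `M + M`, so one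
  -- radius makes all their tails small.
  obtain ⟨k, hk⟩ := (ENNReal.tendsto_nhds_zero.1 htail _ hε2).exists
  have hloc := ENNReal.Tendsto.const_mul (hc k) (.inr hB')
  rw [mul_zero] at hloc
  filter_upwards [ENNReal.tendsto_nhds_zero.1 hloc _ hε2] with n hn
  set ψ := φ (σ n.1) - φ (σ n.2) with hψ
  have hψt : IsTest Set.univ ψ := (hφ _).sub (hφ _)
  have hψM : sumNorm p A Set.univ ψ (gradient ψ) ≤ M + M := by
    have hneg : ∀ n, sumNorm p A Set.univ (-φ n) (-gradient (φ n)) ≤ M := fun n => by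
      rw [sumNorm, eLpNorm_neg, eLpNorm_neg]; exact hM n
    rw [hψ, (hφ _).gradient_sub (hφ _), sub_eq_add_neg, sub_eq_add_neg]
    exact (sumNorm_add_le hp.le ((hφ _).aestronglyMeasurable _)
      ((hφ _).aestronglyMeasurable _).neg ((hφ _).aestronglyMeasurable_gradient _)
      ((hφ _).aestronglyMeasurable_gradient _).neg).trans (add_le_add (hM _) (hneg _))
  have hsplit : eLpNorm ψ (ENNReal.ofReal q) (weightedMeasure B Set.univ) ≤
      eLpNorm ψ (ENNReal.ofReal q) (weightedMeasure B (Metric.ball 0 k)) +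
        eLpNorm ψ (ENNReal.ofReal q) (weightedMeasure B (Metric.ball 0 k)ᶜ) := by
    have h := eLpNorm_restrict_union_le (μ := weightedMeasure B Set.univ) ψ hq1
      (Metric.ball 0 k) (Metric.ball 0 k)ᶜ
    rw [Set.union_compl_self] at h
    simpa only [weightedMeasure, Measure.restrict_univ,
      restrict_withDensity measurableSet_ball,
      restrict_withDensity measurableSet_ball.compl] using h
  refine hsplit.trans ?_
  rw [← ENNReal.add_halves ε]
  refine add_le_add ((eLpNorm_weightedMeasure_le ψ (by linarith)).trans hn)
    ((hCb ψ hψt _).trans (le_trans ?_ hk))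
  gcongr

end WholeSpace

end

/-! ### From test functions to `W_A(Ω)`. -/

section

/-- Completeness of `L^q`, in terms of functions. -/
theorem exists_tendsto_eLpNorm_sub {α F : Type*} [MeasurableSpace α] [NormedAddCommGroup F]
    [CompleteSpace F] {ν : Measure α} {r : ℝ≥0∞} (hr : 1 ≤ r) {f : ℕ → α → F}
    (hf : ∀ n, MemLp (f n) r ν)
    (hc : Tendsto (fun n : ℕ × ℕ => eLpNorm (f n.1 - f n.2) r ν) atTop (𝓝 0)) :
    ∃ w : α → F, StronglyMeasurable w ∧ MemLp w r ν ∧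
      Tendsto (fun n => eLpNorm (f n - w) r ν) atTop (𝓝 0) := by
  have : Fact (1 ≤ r) := ⟨hr⟩
  have h1 : CauchySeq fun n => (hf n).toLp (f n) := by
    rw [Lp.cauchySeq_Lp_iff_cauchySeq_eLpNorm]
    refine hc.congr fun n => eLpNorm_congr_ae ?_
    exact ((hf n.1).coeFn_toLp.sub (hf n.2).coeFn_toLp).symm
  obtain ⟨w, hw⟩ := cauchySeq_tendsto_of_complete h1
  refine ⟨w, Lp.stronglyMeasurable w, Lp.memLp w, ?_⟩
  rw [Lp.tendsto_Lp_iff_tendsto_eLpNorm'] at hw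
  refine hw.congr fun n => eLpNorm_congr_ae ?_
  exact (hf n).coeFn_toLp.sub (ae_eq_refl _)

variable {N : ℕ} {A B : EuclideanSpace ℝ (Fin N) → ℝ} {Ω : Set (EuclideanSpace ℝ (Fin N))}
  {p q : ℝ}

/-- A test function on `Ω` is one on the whole space and vanishes off `Ω` together with its
gradient, so both integrals may be taken over either set. -/
theorem HasWeakGradient.restrict {u w : EuclideanSpace ℝ (Fin N) → ℝ}
    {v : EuclideanSpace ℝ (Fin N) → EuclideanSpace ℝ (Fin N)}
    (h : HasWeakGradient Set.univ w v) (hu : u =ᵐ[volume.restrict Ω] w) :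
    HasWeakGradient Ω u v := by
  obtain ⟨hw, hv, hwv⟩ := h
  refine ⟨?_, hv.mono_set (Set.subset_univ _), fun φ hφ => ?_⟩
  · have hwΩ := hw.mono_set (Set.subset_univ Ω)
    intro x hx
    obtain ⟨s, hs, hsi⟩ := hwΩ x hx
    refine ⟨s ∩ Ω, Filter.inter_mem hs self_mem_nhdsWithin, ?_⟩
    have hus : u =ᵐ[volume.restrict (s ∩ Ω)] w :=
      ae_restrict_of_ae_restrict_of_subset Set.inter_subset_right hu
    exact (hsi.mono_set Set.inter_subset_left).congr hus.symm
  · have hzero : ∀ x ∉ Ω, φ x = 0 := fun x hx =>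
      image_eq_zero_of_notMem_tsupport fun h => hx (hφ.2.2 h)
    have hgzero : ∀ x ∉ Ω, gradient φ x = 0 := fun x hx => by
      have hf : fderiv ℝ φ x = 0 := by
        by_contra hne
        exact hx (hφ.2.2 (support_fderiv_subset ℝ hne))
      rw [gradient, hf, map_zero]
    have h1 := hwv φ ⟨hφ.1, hφ.2.1, Set.subset_univ _⟩
    rw [Measure.restrict_univ] at h1
    have h2 : ∫ x in Ω, u x • gradient φ x = ∫ x in Ω, w x • gradient φ x :=
      integral_congr_ae (hu.mono fun x hx => by simp only [hx])
    have h3 : ∫ x in Ω, w x • gradient φ x = ∫ x, w x • gradient φ x :=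
      setIntegral_eq_integral_of_forall_compl_eq_zero fun x hx => by rw [hgzero x hx, smul_zero]
    have h4 : ∫ x in Ω, φ x • v x = ∫ x, φ x • v x :=
      setIntegral_eq_integral_of_forall_compl_eq_zero fun x hx => by rw [hzero x hx, zero_smul]
    rw [h2, h3, h4, h1]

/-- The pair `(u, v)` is a limit on `Ω` of pairs `(φ, ∇φ)` of test functions on the whole space. -/
structure IsTestLimit (p : ℝ) (A : EuclideanSpace ℝ (Fin N) → ℝ)
    (Ω : Set (EuclideanSpace ℝ (Fin N))) (u : EuclideanSpace ℝ (Fin N) → ℝ)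
    (v : EuclideanSpace ℝ (Fin N) → EuclideanSpace ℝ (Fin N)) : Prop where
  aestronglyMeasurable_left : AEStronglyMeasurable u (volume.restrict Ω)
  aestronglyMeasurable_right : AEStronglyMeasurable v (volume.restrict Ω)
  exists_seq : ∃ φ : ℕ → EuclideanSpace ℝ (Fin N) → ℝ, (∀ n, IsTest Set.univ (φ n)) ∧
    Tendsto (fun n => sumNorm p A Ω (u - φ n) (v - gradient (φ n))) atTop (𝓝 0)

/-- The field `v` is the weak gradient of an extension to the whole space. Uniqueness of weak
gradients on `Ω` makes its norm there independent of the extension; the factor two pays for passing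
from `pairNorm` to `sumNorm`. -/
theorem MemW.exists_isTestLimit {u : EuclideanSpace ℝ (Fin N) → ℝ} (hu : MemW p A Ω u)
    (hp : 0 < p) (hA : AEMeasurable A) (hΩ : IsOpen Ω) :
    ∃ v, IsTestLimit p A Ω u v ∧ sumNorm p A Ω u v ≤ 2 * WNorm p A Ω u := by
  obtain ⟨w, ⟨v, hwv, φ, hφ, hlim⟩, huw⟩ := hu
  have huv : HasWeakGradient Ω u v := hwv.restrict huw
  refine ⟨v, ⟨huv.1.aestronglyMeasurable, huv.2.1.aestronglyMeasurable, φ, hφ, ?_⟩, ?_⟩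
  · have h2 := ENNReal.Tendsto.const_mul hlim (a := 2) (.inr (by simp))
    rw [mul_zero] at h2
    refine tendsto_of_tendsto_of_tendsto_of_le_of_le tendsto_const_nhds h2 (fun _ => zero_le)
      (fun n => ?_)
    have hcongr : sumNorm p A Ω (u - φ n) (v - gradient (φ n)) =
        sumNorm p A Ω (w - φ n) (v - gradient (φ n)) := by
      rw [sumNorm, sumNorm, eLpNorm_congr_ae
        (weightedMeasure_absolutelyContinuous.ae_eq (huw.sub (ae_eq_refl (φ n))))]
    rw [hcongr]
    refine (sumNorm_le_two_mul_pairNorm hA hp _ _).trans ?_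
    gcongr
    exact pairNorm_mono_set (Set.subset_univ _) hp _ _
  · refine (sumNorm_le_two_mul_pairNorm hA hp _ _).trans (le_of_eq ?_)
    have hv : weakGradient Ω u =ᵐ[volume.restrict Ω] v := huv.weakGradient_ae_eq hΩ
    rw [WNorm, pairNorm, pairNorm]
    congr 2
    exact lintegral_congr_ae (hv.mono fun x hx => by simp only [hx])

namespace IsTestLimit

variable {u : EuclideanSpace ℝ (Fin N) → ℝ}
  {v : EuclideanSpace ℝ (Fin N) → EuclideanSpace ℝ (Fin N)}

theorem sub_isTest (h : IsTestLimit p A Ω u v) {ψ : EuclideanSpace ℝ (Fin N) → ℝ}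
    (hψ : IsTest Set.univ ψ) : IsTestLimit p A Ω (u - ψ) (v - gradient ψ) := by
  obtain ⟨hu, hv, φ, hφ, hlim⟩ := h
  refine ⟨hu.sub (hψ.aestronglyMeasurable _), hv.sub (hψ.aestronglyMeasurable_gradient _),
    fun n => φ n - ψ, fun n => (hφ n).sub hψ, hlim.congr fun n => ?_⟩
  rw [(hφ n).gradient_sub hψ, sub_sub_sub_cancel_right, sub_sub_sub_cancel_right]

theorem sumNorm_le_add (h : IsTestLimit p A Ω u v) (hp : 1 ≤ p)
    {ψ : EuclideanSpace ℝ (Fin N) → ℝ} (hψ : IsTest Set.univ ψ) :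
    sumNorm p A Ω u v ≤
      sumNorm p A Ω (u - ψ) (v - gradient ψ) + sumNorm p A Ω ψ (gradient ψ) := by
  have := sumNorm_add_le (A := A) hp
    (h.aestronglyMeasurable_left.sub (hψ.aestronglyMeasurable _)) (hψ.aestronglyMeasurable _)
    (h.aestronglyMeasurable_right.sub (hψ.aestronglyMeasurable_gradient _))
    (hψ.aestronglyMeasurable_gradient _)
  rwa [sub_add_cancel, sub_add_cancel] at this

theorem sumNorm_isTest_le_add (h : IsTestLimit p A Ω u v) (hp : 1 ≤ p)
    {ψ : EuclideanSpace ℝ (Fin N) → ℝ} (hψ : IsTest Set.univ ψ) :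
    sumNorm p A Ω ψ (gradient ψ) ≤
      sumNorm p A Ω (u - ψ) (v - gradient ψ) + sumNorm p A Ω u v := by
  have := sumNorm_add_le (A := A) hp
    ((hψ.aestronglyMeasurable _).sub h.aestronglyMeasurable_left) h.aestronglyMeasurable_left
    ((hψ.aestronglyMeasurable_gradient _).sub h.aestronglyMeasurable_right)
    h.aestronglyMeasurable_right
  rwa [sub_add_cancel, sub_add_cancel, sumNorm_sub_comm] at this

theorem sumNorm_lt_top (h : IsTestLimit p A Ω u v) (hp : 1 ≤ p) (hA : MemLp A ⊤ volume) :
    sumNorm p A Ω u v < ⊤ := by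
  obtain ⟨φ, hφ, hlim⟩ := h.exists_seq
  obtain ⟨n, hn⟩ := (ENNReal.tendsto_nhds_zero.1 hlim 1 one_pos).exists
  exact (h.sumNorm_le_add hp (hφ n)).trans_lt (ENNReal.add_lt_top.2
    ⟨hn.trans_lt ENNReal.one_lt_top, (hφ n).sumNorm_lt_top hA (by linarith)⟩)

/-- An embedding inequality for test functions extends to their limits. -/
theorem eLpNorm_le (h : IsTestLimit p A Ω u v) (hp : 1 ≤ p) (hA : AEMeasurable A)
    (hA_pos : ∀ᵐ x, 0 < A x) {C : ℝ≥0∞} (hC : C ≠ ⊤)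
    (hemb : ∀ φ, IsTest Set.univ φ →
      eLpNorm φ (ENNReal.ofReal q) (weightedMeasure B Ω) ≤ C * sumNorm p A Ω φ (gradient φ)) :
    eLpNorm u (ENNReal.ofReal q) (weightedMeasure B Ω) ≤ C * sumNorm p A Ω u v := by
  obtain ⟨φ, hφ, hlim⟩ := h.exists_seq
  have hp0 : 0 < p := by linarith
  have hlim' : Tendsto (fun n => eLpNorm (φ n - u) (ENNReal.ofReal p) (weightedMeasure A Ω))
      atTop (𝓝 0) := by
    refine tendsto_of_tendsto_of_tendsto_of_le_of_le tendsto_const_nhds hlim (fun _ => zero_le)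
      (fun n => ?_)
    simp only [eLpNorm_sub_comm (φ n) u]
    exact le_add_self
  -- Convergence in `L^p(A dx)` gives a subsequence converging almost everywhere for `A dx`. As `A >
  -- 0`, this means Lebesgue-almost everywhere on `Ω`, hence also almost everywhere for `B dx`, and
  -- Fatou's lemma applies.
  obtain ⟨ns, hns, hae⟩ := (tendstoInMeasure_of_tendsto_eLpNorm (by simpa using hp0)
    (fun n => (hφ n).aestronglyMeasurable _)
    (h.aestronglyMeasurable_left.mono_ac weightedMeasure_absolutelyContinuous)
    hlim').exists_seq_tendsto_ae
  have hae' : ∀ᵐ x ∂(weightedMeasure B Ω), Tendsto (fun i => φ (ns i) x) atTop (𝓝 (u x)) :=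
    weightedMeasure_absolutelyContinuous.ae_le
      ((absolutelyContinuous_weightedMeasure hA hA_pos).ae_le hae)
  refine (Lp.eLpNorm_lim_le_liminf_eLpNorm (fun n => (hφ (ns n)).aestronglyMeasurable _) u
    hae').trans ?_
  have hbound : Tendsto (fun n => C * (sumNorm p A Ω (u - φ (ns n)) (v - gradient (φ (ns n))) +
      sumNorm p A Ω u v)) atTop (𝓝 (C * sumNorm p A Ω u v)) := by
    have h1 := (hlim.comp hns.tendsto_atTop).add_const (sumNorm p A Ω u v)
    rw [zero_add] at h1
    exact ENNReal.Tendsto.const_mul h1 (.inr hC)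
  rw [← hbound.liminf_eq]
  refine liminf_le_liminf (.of_forall fun n => (hemb _ (hφ _)).trans ?_)
  gcongr
  exact h.sumNorm_isTest_le_add hp (hφ _)

end IsTestLimit

/-- The weighted embedding and its compactness follow from the corresponding properties of test
functions. -/
theorem compact_embedding_of_isTest (hp : 1 < p) (hpq : p < q) (hA : MemLp A ⊤ volume)
    (hA_pos : ∀ᵐ x, 0 < A x) (hB : AEMeasurable B) (hΩ : IsOpen Ω)
    (hemb : ∃ C : ℝ≥0∞, C ≠ ⊤ ∧ ∀ φ, IsTest Set.univ φ →
      eLpNorm φ (ENNReal.ofReal q) (weightedMeasure B Ω) ≤ C * sumNorm p A Ω φ (gradient φ))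
    (hcomp : ∀ φ : ℕ → EuclideanSpace ℝ (Fin N) → ℝ, (∀ n, IsTest Set.univ (φ n)) →
      ∀ M : ℝ≥0, (∀ n, sumNorm p A Ω (φ n) (gradient (φ n)) ≤ M) →
      ∃ σ : ℕ → ℕ, StrictMono σ ∧ Tendsto (fun n : ℕ × ℕ =>
        eLpNorm (φ (σ n.1) - φ (σ n.2)) (ENNReal.ofReal q) (weightedMeasure B Ω))
          atTop (𝓝 0)) :
    (∀ u, MemW p A Ω u → MemLqB q B Ω u) ∧
    (∃ C : ℝ, 0 < C ∧ ∀ u, MemW p A Ω u →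
      LqBNorm q B Ω u ≤ ENNReal.ofReal C * WNorm p A Ω u) ∧
    (∀ u : ℕ → EuclideanSpace ℝ (Fin N) → ℝ, (∀ n, MemW p A Ω (u n)) →
      (∃ M : ℝ, ∀ n, WNorm p A Ω (u n) ≤ ENNReal.ofReal M) →
      ∃ (σ : ℕ → ℕ) (w : EuclideanSpace ℝ (Fin N) → ℝ), StrictMono σ ∧ MemLqB q B Ω w ∧
        Tendsto (fun n => LqBNorm q B Ω (u (σ n) - w)) atTop (𝓝 0)) := by
  have hp0 : 0 < p := by linarith
  have hq0 : 0 < q := by linarith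
  have hq1 : 1 ≤ ENNReal.ofReal q := by
    rw [← ENNReal.ofReal_one]; exact ENNReal.ofReal_le_ofReal (by linarith)
  have hAm := hA.1.aemeasurable
  obtain ⟨C, hC, hCb⟩ := hemb
  have hmem : ∀ u : EuclideanSpace ℝ (Fin N) → ℝ, AEStronglyMeasurable u (volume.restrict Ω) →
      eLpNorm u (ENNReal.ofReal q) (weightedMeasure B Ω) < ⊤ → MemLqB q B Ω u := by
    intro u hu hlt
    refine ⟨hu, ?_⟩
    have := lintegral_rpow_enorm_lt_top_of_eLpNorm_lt_top (by simpa using hq0)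
      ENNReal.ofReal_ne_top hlt
    rwa [ENNReal.toReal_ofReal hq0.le, lintegral_weightedMeasure hB] at this
  -- The `2` compares `sumNorm` with `WNorm`; the `1` only ensures positivity when `C = 0`.
  refine ⟨fun u hu => ?_, ⟨2 * C.toReal + 1, by positivity, fun u hu => ?_⟩, fun u hu hM => ?_⟩
  · obtain ⟨v, huv, -⟩ := hu.exists_isTestLimit hp0 hAm hΩ
    exact hmem u huv.aestronglyMeasurable_left
      ((huv.eLpNorm_le hp.le hAm hA_pos hC hCb).trans_lt
        (ENNReal.mul_lt_top hC.lt_top (huv.sumNorm_lt_top hp.le hA)))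
  · obtain ⟨v, huv, hle⟩ := hu.exists_isTestLimit hp0 hAm hΩ
    rw [LqBNorm_eq_eLpNorm hB hq0]
    refine (huv.eLpNorm_le hp.le hAm hA_pos hC hCb).trans ((mul_le_mul' le_rfl hle).trans ?_)
    rw [← mul_assoc, mul_comm C 2]
    gcongr
    rw [ENNReal.ofReal_add (by positivity) zero_le_one, ENNReal.ofReal_mul zero_le_two,
      ENNReal.ofReal_toReal hC]
    simp
  · obtain ⟨M, hM⟩ := hM
    choose v huv hle using fun n => (hu n).exists_isTestLimit hp0 hAm hΩ
    -- Replacing `u n` by a test function with error `1 / (n + 1)` keeps the sequence bounded. By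
    -- the embedding, the error also vanishes in `L^q_B`, so both sequences have the same limits
    -- there.
    have happrox : ∀ n : ℕ, ∃ φ, IsTest Set.univ φ ∧
        sumNorm p A Ω (u n - φ) (v n - gradient φ) ≤ ENNReal.ofReal (1 / ((n : ℝ) + 1)) := by
      intro n
      obtain ⟨φ, hφ, hlim⟩ := (huv n).exists_seq
      obtain ⟨k, hk⟩ := (ENNReal.tendsto_nhds_zero.1 hlim (ENNReal.ofReal (1 / ((n : ℝ) + 1)))
        (by rw [gt_iff_lt, ENNReal.ofReal_pos]; positivity)).exists
      exact ⟨φ k, hφ k, hk⟩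
    choose φ hφ hφu using happrox
    obtain ⟨σ, hσ, hc⟩ := hcomp φ hφ (1 + 2 * M.toNNReal) (fun n => by
      refine ((huv n).sumNorm_isTest_le_add hp.le (hφ n)).trans ?_
      push_cast
      refine add_le_add ((hφu n).trans ?_) ((hle n).trans (mul_le_mul' le_rfl (hM n)))
      rw [← ENNReal.ofReal_one]
      refine ENNReal.ofReal_le_ofReal ?_
      rw [div_le_one (by positivity)]
      linarith [n.cast_nonneg (α := ℝ)])
    -- The limit is taken strongly measurable, because `MemLqB` asks for measurability with respect
    -- to Lebesgue measure rather than `B dx`.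
    obtain ⟨w, hwm, hw, hlim⟩ := exists_tendsto_eLpNorm_sub hq1 (f := fun n => φ (σ n))
      (fun n => ⟨(hφ _).aestronglyMeasurable _, (hCb _ (hφ _)).trans_lt
        (ENNReal.mul_lt_top hC.lt_top ((hφ _).sumNorm_lt_top hA hp0))⟩) hc
    refine ⟨σ, w, hσ, hmem w hwm.aestronglyMeasurable hw.2, ?_⟩
    simp_rw [LqBNorm_eq_eLpNorm hB hq0]
    have herr : Tendsto (fun n => C * ENNReal.ofReal (1 / ((σ n : ℝ) + 1))) atTop (𝓝 0) := by
      have h1 := ENNReal.tendsto_ofReal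
        (tendsto_one_div_add_atTop_nhds_zero_nat.comp hσ.tendsto_atTop)
      rw [ENNReal.ofReal_zero] at h1
      simpa using ENNReal.Tendsto.const_mul h1 (.inr hC)
    have hsum := herr.add hlim
    rw [add_zero] at hsum
    refine tendsto_of_tendsto_of_tendsto_of_le_of_le tendsto_const_nhds hsum (fun _ => zero_le)
      (fun n => ?_)
    have hdec : u (σ n) - w = (u (σ n) - φ (σ n)) + (φ (σ n) - w) := by abel
    simp only [hdec]
    have hum : AEStronglyMeasurable (u (σ n)) (weightedMeasure B Ω) :=
      (huv _).aestronglyMeasurable_left.mono_ac weightedMeasure_absolutelyContinuous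
    refine (eLpNorm_add_le (hum.sub ((hφ _).aestronglyMeasurable _))
      (((hφ _).aestronglyMeasurable _).sub hwm.aestronglyMeasurable) hq1).trans ?_
    gcongr
    exact (((huv _).sub_isTest (hφ _)).eLpNorm_le hp.le hAm hA_pos hC hCb).trans
      (mul_le_mul' le_rfl (hφu _))

end

end WeightedSobolev

theorem mainTheorem4 (N : ℕ) (p q : ℝ) (hp : 1 < p) (hpN : p < N)
    (hpq : p < q) (hq : q < WeightedSobolev.pStar N p)
    (A : EuclideanSpace ℝ (Fin N) → ℝ) (hA_pos : ∀ᵐ x, 0 < A x) (hA_bdd : MemLp A (⊤ : ℝ≥0∞) volume)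
    (hA_inv : LocallyIntegrable (fun x => A x ^ (-(1 / (p - 1)))) volume)
    (B : EuclideanSpace ℝ (Fin N) → ℝ) (hB_pos : ∀ᵐ x, 0 < B x) (hB_bdd : MemLp B (⊤ : ℝ≥0∞) volume)
    (hB_int : MemLp B (ENNReal.ofReal
      (WeightedSobolev.pStar N p / (WeightedSobolev.pStar N p - q))) volume)
    (Ω : Set (EuclideanSpace ℝ (Fin N)))
    (hΩ : Ω = Set.univ ∨
      (IsOpen Ω ∧ Bornology.IsBounded Ω ∧ WeightedSobolev.HasC1Boundary Ω)) :
    (∀ u, WeightedSobolev.MemW p A Ω u → WeightedSobolev.MemLqB q B Ω u) ∧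
    (∃ C : ℝ, 0 < C ∧ ∀ u, WeightedSobolev.MemW p A Ω u →
      WeightedSobolev.LqBNorm q B Ω u ≤ ENNReal.ofReal C * WeightedSobolev.WNorm p A Ω u) ∧
    (∀ u : ℕ → EuclideanSpace ℝ (Fin N) → ℝ, (∀ n, WeightedSobolev.MemW p A Ω (u n)) →
      (∃ M : ℝ, ∀ n, WeightedSobolev.WNorm p A Ω (u n) ≤ ENNReal.ofReal M) →
      ∃ (σ : ℕ → ℕ) (w : EuclideanSpace ℝ (Fin N) → ℝ), StrictMono σ ∧
        WeightedSobolev.MemLqB q B Ω w ∧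
        Tendsto (fun n => WeightedSobolev.LqBNorm q B Ω (u (σ n) - w)) atTop (𝓝 0)) := by
  have hκ := WeightedSobolev.mul_sub_one_lt_of_lt_pStar hp hpN hq
  have hAm := hA_bdd.1.aemeasurable
  have hBm := hB_bdd.1.aemeasurable
  rcases hΩ with rfl | ⟨hΩ, hb, hC1⟩
  · exact WeightedSobolev.compact_embedding_of_isTest hp hpq hA_bdd hA_pos hBm isOpen_univ
      (WeightedSobolev.exists_eLpNorm_le_sumNorm_univ hp hpN hpq hq hBm hB_int)
      (fun φ hφ M hM => WeightedSobolev.exists_subseq_univ hp hpN hpq hq hAm hA_pos hA_inv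
        hB_bdd hB_int hφ hM)
  · exact WeightedSobolev.compact_embedding_of_isTest hp hpq hA_bdd hA_pos hBm hΩ
      (WeightedSobolev.exists_eLpNorm_le_sumNorm_of_isBounded hp hpq hκ hAm hA_pos hA_inv
        hB_bdd hΩ hb hC1)
      (fun φ hφ M hM => WeightedSobolev.exists_subseq_of_isBounded hp hpq hκ hAm hA_pos hA_inv
        hB_bdd hΩ hb hC1 hφ hM)
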